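/- Let $\mathrm{SO}(3)$ carry its normalized Haar measure $\sigma$, and let $\|A\|_F=\sqrt{\operatorname{trace}(A^\top A)}$ be the Frobenius norm on $\mathbb{R}^{3\times 3}$. For $m\in\mathbb{N}=\{0,1,2,\dots\}$ and integers $-m\le k,l\le m$, let $\mathcal{D}^m_{k,l}:\mathrm{SO}(3)\to\mathbb{C}$ be the Wigner $\mathcal{D}$-functions, normalized in $L_2(\mathrm{SO}(3),\sigma)$: if $x=R_z(\alpha)R_y(\beta)R_z(\gamma)$ with Euler angles $\alpha,\gamma\in\mathbb{R}$, $\beta\in[0,\pi]$, then $$\mathcal{D}^m_{k,l}(x)=\sqrt{2m+1}\;e^{-ik\alpha}\,d^m_{k,l}(\beta)\,e^{-il\gamma},$$ $$d^m_{k,l}(\beta)=\sqrt{(m+k)!(m-k)!(m+l)!(m-l)!}\;\sum_s\frac{(-1)^{k-l+s}\cos(\tfrac{\beta}{2})^{2m+l-k-2s}\sin(\tfrac{\beta}{2})^{k-l+2s}}{(m+l-s)!\,s!\,(k-l+s)!\,(m-k-s)!},$$ the sum being over all integers $s$ for which the factorials have nonnegative arguments. Let $p>-3$. Then, for all $m\in\mathbb{N}$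 and $-m\le k,l\le m$, the integral $$a_m(p)=\iint_{\mathrm{SO}(3)\times\mathrm{SO}(3)}2^{-p/2}\|x-y\|_F^p\;\overline{\mathcal{D}^m_{k,l}(x)}\,\mathcal{D}^m_{k,l}(y)\,d\sigma(x)\,d\sigma(y)$$ converges absolutely, does not depend on $k,l$, and equals $$a_m(p)=\frac{2^p\,\Gamma(\frac p2+\frac32)}{\sqrt{\pi}\,\Gamma(-\frac p2)}\cdot\frac{\Gamma(-\frac p2+m)}{\Gamma(\frac p2+2+m)}\cdot\frac{1}{m+\frac12},$$ where for $p\in2\mathbb{N}$ the quotient $\Gamma(-\frac p2+m)/\Gamma(-\frac p2)$ is read as the Pochhammer symbol $(-\frac p2)_m=\prod_{i=0}^{m-1}(-\frac p2+i)$. In particular, if $p\notin2\mathbb{N}$, then $$|a_m(p)|=\left|\frac{2^p\,\Gamma(\frac p2+\frac32)}{\sqrt{\pi}\,\Gamma(-\frac p2)}\right|m^{-(p+3)}(1+o(1)),\qquad m\to\infty.$$ If $p\in2\mathbb{N}$, then the Fourier expansion of the kernel terminates: $a_m(p)=0$ for all $m>\frac p2$, and $$2^{-p/2}\|x-y\|_F^p=\sum_{m=0}^{p/2}a_m(p)\sum_{k,l=-m}^m\mathcal{D}^m_{k,l}(x)\overline{\mathcal{D}^m_{k,l}(y)},\qquad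 x,y\in\mathrm{SO}(3)$$ (with $0^0=1$ when $p=0$). -/

import Mathlib

open MeasureTheory Filter Topology

namespace WignerSO3

/-- The rotation group `SO(3)`, with the topology induced from `ℝ^{3×3}`. -/
abbrev SO3 : Type := ↥(Matrix.specialOrthogonalGroup (Fin 3) ℝ)

theorem transpose_mul_self (x : SO3) : x.1.transpose * x.1 = 1 :=
  (Matrix.mem_orthogonalGroup_iff' _ _).1 (Matrix.mem_specialOrthogonalGroup_iff.1 x.2).1

theorem det_eq_one (x : SO3) : x.1.det = 1 :=
  (Matrix.mem_specialOrthogonalGroup_iff.1 x.2).2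

theorem mem_SO3_iff {A : Matrix (Fin 3) (Fin 3) ℝ} :
    A ∈ Matrix.specialOrthogonalGroup (Fin 3) ℝ ↔ A.transpose * A = 1 ∧ A.det = 1 := by
  rw [Matrix.mem_specialOrthogonalGroup_iff, Matrix.mem_orthogonalGroup_iff']

instance : IsTopologicalGroup SO3 where
  continuous_inv := by
    refine Continuous.subtype_mk (f := fun x : SO3 => x.1.transpose) ?_ _
    exact Continuous.matrix_transpose continuous_subtype_val

instance : CompactSpace SO3 := by
  refine isCompact_iff_compactSpace.1 ?_
  have hK : IsCompact (Set.pi Set.univ fun _ : Fin 3 => Set.pi Set.univ fun _ : Fin 3 =>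
      Set.Icc (-1 : ℝ) 1) :=
    isCompact_univ_pi fun _ => isCompact_univ_pi fun _ => isCompact_Icc
  have hset : (Matrix.specialOrthogonalGroup (Fin 3) ℝ : Set (Matrix (Fin 3) (Fin 3) ℝ)) =
      {A | A.transpose * A = 1} ∩ {A | A.det = 1} := by
    ext A
    exact mem_SO3_iff
  refine IsCompact.of_isClosed_subset hK ?_ ?_
  · rw [hset]
    refine IsClosed.inter (isClosed_eq ?_ continuous_const) (isClosed_eq ?_ continuous_const)
    · exact (Continuous.matrix_transpose continuous_id).matrix_mul continuous_id
    · exact continuous_id.matrix_det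
  · intro A hA i _ j _
    have h := congrFun (congrFun (mem_SO3_iff.1 hA).1 j) j
    simp only [Matrix.mul_apply, Matrix.transpose_apply, Matrix.one_apply_eq] at h
    have h2 : A i j * A i j ≤ 1 := by
      rw [← h]
      exact Finset.single_le_sum (f := fun t => A t j * A t j)
        (fun t _ => mul_self_nonneg _) (Finset.mem_univ i)
    exact abs_le.1 (abs_le_one_iff_mul_self_le_one.2 h2)

instance : MeasurableSpace SO3 := borel SO3

instance : BorelSpace SO3 := ⟨rfl⟩

/-- The normalized Haar measure on `SO(3)`. -/
noncomputable def haarSO3 : Measure SO3 := Measure.haarMeasure ⊤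

/-- The Frobenius norm, induced by the trace inner product `⟨A, B⟩ = trace (Aᵀ B)`. -/
noncomputable def frobeniusNorm (A : Matrix (Fin 3) (Fin 3) ℝ) : ℝ :=
  Real.sqrt (A.transpose * A).trace

/-- The kernel `2^{-p/2} ‖x - y‖_F^p` on `SO(3)`. -/
noncomputable def kernel (p : ℝ) (x y : SO3) : ℝ :=
  (2 : ℝ) ^ (-p / 2) * frobeniusNorm (x.1 - y.1) ^ p

/-- Rotation about the `z`-axis by the angle `t`. -/
noncomputable def rotZ (t : ℝ) : Matrix (Fin 3) (Fin 3) ℝ :=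
  !![Real.cos t, -Real.sin t, 0; Real.sin t, Real.cos t, 0; 0, 0, 1]

/-- Rotation about the `y`-axis by the angle `t`. -/
noncomputable def rotY (t : ℝ) : Matrix (Fin 3) (Fin 3) ℝ :=
  !![Real.cos t, 0, Real.sin t; 0, 1, 0; -Real.sin t, 0, Real.cos t]

/-- `(α, β, γ)` are Euler angles of `x` in the `z-y-z` convention. -/
def IsEulerAngles (x : SO3) (α β γ : ℝ) : Prop :=
  β ∈ Set.Icc 0 Real.pi ∧ x.1 = rotZ α * rotY β * rotZ γ

theorem rotZ_transpose_mul (t : ℝ) : (rotZ t).transpose * rotZ t = 1 := by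
  have := Real.sin_sq_add_cos_sq t
  ext i j
  fin_cases i <;> fin_cases j <;>
    simp [rotZ, Matrix.mul_apply, Fin.sum_univ_three] <;> nlinarith

theorem rotY_transpose_mul (t : ℝ) : (rotY t).transpose * rotY t = 1 := by
  have := Real.sin_sq_add_cos_sq t
  ext i j
  fin_cases i <;> fin_cases j <;>
    simp [rotY, Matrix.mul_apply, Fin.sum_univ_three] <;> nlinarith

theorem rotZ_mem (t : ℝ) : rotZ t ∈ Matrix.specialOrthogonalGroup (Fin 3) ℝ := by
  refine mem_SO3_iff.2 ⟨rotZ_transpose_mul t, ?_⟩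
  have := Real.sin_sq_add_cos_sq t
  simp [rotZ, Matrix.det_fin_three]
  nlinarith

theorem rotY_mem (t : ℝ) : rotY t ∈ Matrix.specialOrthogonalGroup (Fin 3) ℝ := by
  refine mem_SO3_iff.2 ⟨rotY_transpose_mul t, ?_⟩
  have := Real.sin_sq_add_cos_sq t
  simp [rotY, Matrix.det_fin_three]
  nlinarith

theorem exists_polar (a b : ℝ) : ∃ t : ℝ, a = Real.sqrt (a ^ 2 + b ^ 2) * Real.cos t ∧
    b = Real.sqrt (a ^ 2 + b ^ 2) * Real.sin t := by
  have hn : ‖(⟨a, b⟩ : ℂ)‖ = Real.sqrt (a ^ 2 + b ^ 2) := by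
    rw [Complex.norm_def, Complex.normSq_mk]
    ring_nf
  refine ⟨Complex.arg ⟨a, b⟩, ?_, ?_⟩
  · rw [← hn, Complex.norm_mul_cos_arg]
  · rw [← hn, Complex.norm_mul_sin_arg]

theorem eq_rotZ_of_fix (z : SO3) (h0 : z.1 0 2 = 0) (h1 : z.1 1 2 = 0) (h2 : z.1 2 2 = 1) :
    ∃ t : ℝ, z.1 = rotZ t := by
  have ho := transpose_mul_self z
  have hd := det_eq_one z
  have e : ∀ i j, ∑ t, z.1 t i * z.1 t j = (1 : Matrix (Fin 3) (Fin 3) ℝ) i j := by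
    intro i j
    rw [← ho]
    simp [Matrix.mul_apply]
  simp only [Fin.sum_univ_three] at e
  have e02 := e 0 2
  have e12 := e 1 2
  have e00 := e 0 0
  have e11 := e 1 1
  simp [h0, h1, h2] at e02 e12 e00 e11
  rw [Matrix.det_fin_three] at hd
  simp [h0, h1, h2, e02, e12] at hd e00 e11
  have hsq : (z.1 0 0 - z.1 1 1) ^ 2 + (z.1 0 1 + z.1 1 0) ^ 2 = 0 := by nlinarith
  have ha : z.1 1 1 = z.1 0 0 := by
    nlinarith [sq_nonneg (z.1 0 0 - z.1 1 1), sq_nonneg (z.1 0 1 + z.1 1 0)]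
  have hb : z.1 0 1 = -z.1 1 0 := by
    nlinarith [sq_nonneg (z.1 0 0 - z.1 1 1), sq_nonneg (z.1 0 1 + z.1 1 0)]
  obtain ⟨t, ht, ht'⟩ := exists_polar (z.1 0 0) (z.1 1 0)
  have h1' : Real.sqrt (z.1 0 0 ^ 2 + z.1 1 0 ^ 2) = 1 := by
    rw [Real.sqrt_eq_one]
    nlinarith
  rw [h1', one_mul] at ht ht'
  refine ⟨t, ?_⟩
  ext i j
  fin_cases i <;> fin_cases j <;> simp [rotZ, h0, h1, h2, e02, e12, ha, hb, ← ht, ← ht']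

/-- Every rotation has Euler angles. -/
theorem exists_eulerAngles (x : SO3) :
    ∃ e : ℝ × ℝ × ℝ, IsEulerAngles x e.1 e.2.1 e.2.2 := by
  have hc := congrFun (congrFun (transpose_mul_self x) 2) 2
  simp [Matrix.mul_apply, Fin.sum_univ_three] at hc
  have hle : x.1 2 2 ≤ 1 := by nlinarith [sq_nonneg (x.1 0 2), sq_nonneg (x.1 1 2)]
  have hge : -1 ≤ x.1 2 2 := by nlinarith [sq_nonneg (x.1 0 2), sq_nonneg (x.1 1 2)]
  obtain ⟨α, h0, h1⟩ := exists_polar (x.1 0 2) (x.1 1 2)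
  set β := Real.arccos (x.1 2 2) with hβ
  have hcos : Real.cos β = x.1 2 2 := Real.cos_arccos hge hle
  have hsin : Real.sqrt (x.1 0 2 ^ 2 + x.1 1 2 ^ 2) = Real.sin β := by
    rw [hβ, Real.sin_arccos]
    congr 1
    linarith
  rw [hsin] at h0 h1
  let z : SO3 := (⟨rotY β, rotY_mem β⟩ : SO3)⁻¹ * (⟨rotZ α, rotZ_mem α⟩ : SO3)⁻¹ * x
  have hz : z.1 = (rotY β).transpose * (rotZ α).transpose * x.1 := rfl
  have hx : x = ⟨rotZ α, rotZ_mem α⟩ * ⟨rotY β, rotY_mem β⟩ * z := by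
    simp only [z]
    group
  have t1 := Real.sin_sq_add_cos_sq α
  have t2 := Real.sin_sq_add_cos_sq β
  obtain ⟨γ, hγ⟩ := eq_rotZ_of_fix z
    (by
      rw [hz]
      simp [rotY, rotZ, Matrix.mul_apply, Fin.sum_univ_three]
      rw [h0, h1, ← hcos]
      linear_combination (Real.sin β * Real.cos β) * t1)
    (by
      rw [hz]
      simp [rotY, rotZ, Matrix.mul_apply, Fin.sum_univ_three]
      rw [h0, h1]
      ring)
    (by
      rw [hz]
      simp [rotY, rotZ, Matrix.mul_apply, Fin.sum_univ_three]
      rw [h0, h1, ← hcos]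
      linear_combination (Real.sin β ^ 2) * t1 + t2)
  refine ⟨(α, β, γ), ⟨Real.arccos_nonneg _, Real.arccos_le_pi _⟩, ?_⟩
  have := congrArg Subtype.val hx
  rw [this]
  change rotZ α * rotY β * z.1 = _
  rw [hγ]

/-- The (small) Wigner function `d^m_{k,l}(β)`, for `-m ≤ k, l ≤ m`. The sum extends over all `s`
for which the arguments of all the factorials in the denominator are nonnegative. -/
noncomputable def smallD (m : ℕ) (k l : ℤ) (β : ℝ) : ℝ :=
  Real.sqrt (((m + k).toNat.factorial : ℝ) * ((m - k).toNat.factorial : ℝ) *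
      ((m + l).toNat.factorial : ℝ) * ((m - l).toNat.factorial : ℝ)) *
    ∑ s ∈ (Finset.range (2 * m + 1)).filter
        (fun s : ℕ => 0 ≤ m + l - (s : ℤ) ∧ 0 ≤ k - l + (s : ℤ) ∧ 0 ≤ m - k - (s : ℤ)),
      (-1 : ℝ) ^ (k - l + s).toNat /
          (((m + l - s).toNat.factorial : ℝ) * (s.factorial : ℝ) *
            ((k - l + s).toNat.factorial : ℝ) * ((m - k - s).toNat.factorial : ℝ)) *
        Real.cos (β / 2) ^ (2 * m + l - k - 2 * s).toNat *
        Real.sin (β / 2) ^ (k - l + 2 * s).toNat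

/-- The Wigner function in Euler angles, `√(2m+1) e^{-ikα} d^m_{k,l}(β) e^{-ilγ}`; the factor
`√(2m+1)` makes it a unit vector in `L²` of the normalized Haar measure. -/
noncomputable def eulerD (m : ℕ) (k l : ℤ) (α β γ : ℝ) : ℂ :=
  (Real.sqrt (2 * m + 1) : ℂ) * Complex.exp (-Complex.I * k * α) * (smallD m k l β : ℂ) *
    Complex.exp (-Complex.I * l * γ)

/-- The `L²`-normalized Wigner `D`-function `D^m_{k,l}` on `SO(3)`. By `wignerD_eq` below the value
does not depend on the choice of the Euler angles. -/
noncomputable def wignerD (m : ℕ) (k l : ℤ) (x : SO3) : ℂ :=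
  eulerD m k l (exists_eulerAngles x).choose.1 (exists_eulerAngles x).choose.2.1
    (exists_eulerAngles x).choose.2.2

theorem smallD_zero {m : ℕ} {k l : ℤ} (h : k ≠ l) : smallD m k l 0 = 0 := by
  unfold smallD
  refine mul_eq_zero_of_right _ (Finset.sum_eq_zero fun s hs => ?_)
  rw [Finset.mem_filter] at hs
  refine mul_eq_zero_of_right _ ?_
  rw [zero_div, Real.sin_zero]
  exact zero_pow (by omega)

theorem smallD_pi {m : ℕ} {k l : ℤ} (h : l ≠ -k) : smallD m k l Real.pi = 0 := by
  unfold smallD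
  refine mul_eq_zero_of_right _ (Finset.sum_eq_zero fun s hs => ?_)
  rw [Finset.mem_filter] at hs
  refine mul_eq_zero_of_left (mul_eq_zero_of_right _ ?_) _
  rw [Real.cos_pi_div_two]
  exact zero_pow (by omega)

theorem exp_congr (k : ℤ) {t t' : ℝ} (hc : Real.cos t = Real.cos t')
    (hs : Real.sin t = Real.sin t') :
    Complex.exp (-Complex.I * k * t) = Complex.exp (-Complex.I * k * t') := by
  have key : ∀ r : ℝ, Complex.exp (-Complex.I * k * r) =
      ((Real.cos r : ℂ) + (Real.sin r : ℂ) * Complex.I) ^ (-k) := by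
    intro r
    rw [Complex.ofReal_cos, Complex.ofReal_sin, ← Complex.exp_mul_I, ← Complex.exp_int_mul]
    congr 1
    push_cast
    ring
  rw [key, key, hc, hs]

theorem eulerD_congr {x : SO3} {α β γ α' β' γ' : ℝ} (h : IsEulerAngles x α β γ)
    (h' : IsEulerAngles x α' β' γ') (m : ℕ) (k l : ℤ) :
    eulerD m k l α β γ = eulerD m k l α' β' γ' := by
  obtain ⟨hβ, hx⟩ := h
  obtain ⟨hβ', hx'⟩ := h'
  rw [hx] at hx'
  have e22 := congrFun (congrFun hx' 2) 2
  simp [rotY, rotZ, Matrix.mul_apply, Fin.sum_univ_three] at e22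
  have hb : β = β' := Real.injOn_cos hβ hβ' e22
  subst hb
  have e02 := congrFun (congrFun hx' 0) 2
  have e12 := congrFun (congrFun hx' 1) 2
  have e20 := congrFun (congrFun hx' 2) 0
  have e21 := congrFun (congrFun hx' 2) 1
  have e00 := congrFun (congrFun hx' 0) 0
  have e10 := congrFun (congrFun hx' 1) 0
  simp [rotY, rotZ, Matrix.mul_apply, Fin.sum_univ_three] at e02 e12 e20 e21 e00 e10
  unfold eulerD
  by_cases hs : Real.sin β = 0
  · have h0π : β = 0 ∨ β = Real.pi := by
      by_contra hcon
      push Not at hcon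
      exact (Real.sin_pos_of_pos_of_lt_pi (lt_of_le_of_ne hβ.1 (Ne.symm hcon.1))
        (lt_of_le_of_ne hβ.2 hcon.2)).ne' hs
    rcases h0π with rfl | rfl
    · by_cases hkl : k = l
      · subst hkl
        have key := exp_congr k (t := α + γ) (t' := α' + γ')
          (by simp at e00; rw [Real.cos_add, Real.cos_add]; linarith)
          (by simp at e10; rw [Real.sin_add, Real.sin_add]; linarith)
        push_cast at key
        rw [mul_add, mul_add, Complex.exp_add, Complex.exp_add] at key
        linear_combination (Real.sqrt (2 * m + 1) : ℂ) * (smallD m k k 0 : ℂ) * key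
      · simp [smallD_zero hkl]
    · by_cases hkl : l = -k
      · subst hkl
        have key := exp_congr k (t := α - γ) (t' := α' - γ')
          (by simp at e00; rw [Real.cos_sub, Real.cos_sub]; linarith)
          (by simp at e10; rw [Real.sin_sub, Real.sin_sub]; linarith)
        push_cast at key ⊢
        rw [mul_sub, mul_sub, sub_eq_add_neg, sub_eq_add_neg, Complex.exp_add,
          Complex.exp_add] at key
        have r : ∀ g : ℂ, -Complex.I * -(k : ℂ) * g = -(-Complex.I * k * g) := fun g => by ring
        rw [r, r]
        linear_combination (Real.sqrt (2 * m + 1) : ℂ) * (smallD m k (-k) Real.pi : ℂ) * key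
      · simp [smallD_pi hkl]
  · simp only [hs, or_false] at e02 e12 e20 e21
    rw [exp_congr k e02 e12, exp_congr l e20 e21]

/-- `wignerD` is given by the Euler angle formula for every choice of Euler angles. -/
theorem wignerD_eq {x : SO3} {α β γ : ℝ} (h : IsEulerAngles x α β γ) (m : ℕ) (k l : ℤ) :
    wignerD m k l x = eulerD m k l α β γ :=
  eulerD_congr (exists_eulerAngles x).choose_spec h m k l

/-- The integrand `2^{-p/2} ‖x - y‖_F^p conj(D^m_{k,l}(x)) D^m_{k,l}(y)`, where `z = (x, y)`. -/
noncomputable def coeffIntegrand (p : ℝ) (m : ℕ) (k l : ℤ) (z : SO3 × SO3) : ℂ :=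
  (kernel p z.1 z.2 : ℂ) * (starRingEnd ℂ) (wignerD m k l z.1) * wignerD m k l z.2

/-- The coefficient of the kernel `2^{-p/2} ‖x - y‖_F^p` with respect to `D^m_{k,l}`. -/
noncomputable def wignerCoeff (p : ℝ) (m : ℕ) (k l : ℤ) : ℂ :=
  ∫ z, coeffIntegrand p m k l z ∂(haarSO3.prod haarSO3)

end WignerSO3

open WignerSO3

namespace WignerSO3

/-! The functions `D^m_{k,l} / √(2m+1)` are the entries of an irreducible unitary representation
`wignerRep m`. Lifting a rotation to a unit quaternion, hence to a `2 × 2` matrix, and taking its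
`2m`-th symmetric power in normalized monomials reproduces the Euler angle formula term by term. The
even degree makes the sign of the lift irrelevant.

The kernel depends only on `x⁻¹y`, and only through its rotation angle `ω`: it equals `2^p
(sin²(ω/2))^(p/2)`. Schur's lemma (`eq_smul_one_of_commute`) makes the Fourier transform of such a
central function a scalar matrix. Hence `a_m(p)` is independent of `k, l` and is `1/(2m+1)` times
the integral of the function against the character (`integral_central_kernel`). The character is a
polynomial `charPoly m` in `sin²(ω/2)` obeying a three-term recurrence.

It remains to know the law of `sin²(ω/2)` under Haar measure. It is Beta(3/2, 1/2), found without a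
Jacobian: both laws live on `[0,1]` and integrate `charPoly m` to `0` for `m > 0` and to `1` for `m
= 0`, and the `charPoly m` span all polynomials (`map_sinSqHalf`). Against this law the moment of
`x^q charPoly m` is `charMoment m q`: Beta integrals give `m = 0`, and the recurrence gives the
rest, since multiplying by `x` shifts `q` to `q + 1`.

For `p = 2n` the Pochhammer factor `(-n)_m` vanishes beyond `m = n`, and summation by parts with the
same recurrence gives the finite expansion (`pow_eq_sum_charMoment`). Otherwise the asymptotics
follow from Euler's limit formula for `Γ`. -/

/-! ### Symmetric powers of `2 × 2` matrices -/

/-- The coefficient of `u ^ i v ^ (n - i)` in `(g₀₀ u + g₁₀ v) ^ j (g₀₁ u + g₁₁ v) ^ (n - j)`,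
divided by `j! (n - j)!`. -/
noncomputable def symEntry (n i j : ℕ) (g : Matrix (Fin 2) (Fin 2) ℂ) : ℂ :=
  ∑ s ∈ (Finset.range (n + 1)).filter (fun s => s ≤ j ∧ j ≤ i + s ∧ i + s ≤ n),
    g 0 0 ^ (j - s) * g 0 1 ^ (i + s - j) * g 1 0 ^ s * g 1 1 ^ (n - i - s) /
      (((j - s).factorial : ℂ) * (s.factorial : ℂ) * ((i + s - j).factorial : ℂ) *
        ((n - i - s).factorial : ℂ))

/-- Expand both powers binomially. In `symEntry`, `s` counts the factors `v` taken from the first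
power, so `i + s - j` factors `u` come from the second. -/
theorem sum_symEntry (n j : ℕ) (hj : j ≤ n) (g : Matrix (Fin 2) (Fin 2) ℂ) (u v : ℂ) :
    (g 0 0 * u + g 1 0 * v) ^ j * (g 0 1 * u + g 1 1 * v) ^ (n - j) =
      j.factorial * (n - j).factorial *
        ∑ i ∈ Finset.range (n + 1), symEntry n i j g * (u ^ i * v ^ (n - i)) := by
  rw [add_comm (g 0 0 * u), add_pow, add_pow, Finset.sum_mul_sum]
  unfold symEntry
  simp_rw [Finset.sum_mul, Finset.mul_sum]
  rw [Finset.sum_sigma', Finset.sum_sigma']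
  refine Finset.sum_bij' (fun x _ => ⟨j - x.1 + x.2, x.1⟩) (fun y _ => ⟨y.2, y.1 + y.2 - j⟩)
    ?_ ?_ ?_ ?_ ?_
  · rintro ⟨s, t⟩ h
    simp only [Finset.mem_sigma, Finset.mem_range, Finset.mem_filter] at h ⊢
    omega
  · rintro ⟨i, s⟩ h
    simp only [Finset.mem_sigma, Finset.mem_range, Finset.mem_filter] at h ⊢
    omega
  · rintro ⟨s, t⟩ h
    simp only [Finset.mem_sigma, Finset.mem_range] at h
    simp only [Sigma.mk.injEq, heq_eq_eq, true_and]
    omega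
  · rintro ⟨i, s⟩ h
    simp only [Finset.mem_sigma, Finset.mem_range, Finset.mem_filter] at h
    simp only [Sigma.mk.injEq, heq_eq_eq, and_true]
    omega
  · rintro ⟨s, t⟩ h
    simp only [Finset.mem_sigma, Finset.mem_range] at h
    obtain ⟨h1, h2⟩ := h
    have e1 : j - s + t + s - j = t := by omega
    have e2 : n - (j - s + t) = s + (n - j - t) := by omega
    simp only [e1, e2, add_tsub_cancel_left]
    rw [Nat.cast_choose ℂ (by omega : s ≤ j), Nat.cast_choose ℂ (by omega : t ≤ n - j)]
    rw [mul_pow, mul_pow, mul_pow, mul_pow, pow_add, pow_add]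
    simp only [div_eq_mul_inv, mul_inv]
    ring

theorem eq_of_sum_mul_pow_eq {n : ℕ} {f g : ℕ → ℂ}
    (h : ∀ u : ℂ, ∑ i ∈ Finset.range n, f i * u ^ i = ∑ i ∈ Finset.range n, g i * u ^ i)
    {i : ℕ} (hi : i < n) : f i = g i := by
  have hp : (∑ i ∈ Finset.range n, Polynomial.C (f i) * Polynomial.X ^ i) =
      ∑ i ∈ Finset.range n, Polynomial.C (g i) * Polynomial.X ^ i := by
    refine Polynomial.funext fun u => ?_
    simpa [Polynomial.eval_finsetSum] using h u
  have := congrArg (fun q => Polynomial.coeff q i) hp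
  simpa [Polynomial.finsetSum_coeff, Polynomial.coeff_C_mul, Polynomial.coeff_X_pow, hi] using this

/-- Substituting the linear forms of `g` into the generating identity for `h` gives the one for `g *
h`. Coefficients can be compared after setting `v = 1`. -/
theorem symEntry_mul (n i j : ℕ) (hi : i ≤ n) (hj : j ≤ n) (g h : Matrix (Fin 2) (Fin 2) ℂ) :
    symEntry n i j (g * h) = ∑ r ∈ Finset.range (n + 1),
      ((r.factorial : ℂ) * (n - r).factorial) * symEntry n i r g * symEntry n r j h := by
  refine eq_of_sum_mul_pow_eq (n := n + 1) (f := fun i => symEntry n i j (g * h))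
    (g := fun i => ∑ r ∈ Finset.range (n + 1),
      ((r.factorial : ℂ) * (n - r).factorial) * symEntry n i r g * symEntry n r j h)
    (fun u => ?_) (by omega)
  have key := sum_symEntry n j hj (g * h) u 1
  have key2 := sum_symEntry n j hj h (g 0 0 * u + g 1 0 * 1) (g 0 1 * u + g 1 1 * 1)
  have e0 : (g * h) 0 0 * u + (g * h) 1 0 * 1 =
      h 0 0 * (g 0 0 * u + g 1 0 * 1) + h 1 0 * (g 0 1 * u + g 1 1 * 1) := by
    simp [Matrix.mul_apply]; ring
  have e1 : (g * h) 0 1 * u + (g * h) 1 1 * 1 =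
      h 0 1 * (g 0 0 * u + g 1 0 * 1) + h 1 1 * (g 0 1 * u + g 1 1 * 1) := by
    simp [Matrix.mul_apply]; ring
  rw [e0, e1, key2] at key
  have f1 := Nat.cast_ne_zero (R := ℂ).2 (Nat.factorial_ne_zero j)
  have f2 := Nat.cast_ne_zero (R := ℂ).2 (Nat.factorial_ne_zero (n - j))
  have key3 := mul_left_cancel₀ (mul_ne_zero f1 f2) key
  simp only [one_pow, mul_one] at key3
  rw [← key3]
  simp_rw [Finset.sum_mul]
  rw [Finset.sum_comm]
  refine Finset.sum_congr rfl fun r hr => ?_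
  have := sum_symEntry n r (by simpa [Nat.lt_succ_iff] using hr) g u 1
  simp only [one_pow, mul_one] at this
  rw [this, Finset.mul_sum, Finset.mul_sum]
  exact Finset.sum_congr rfl fun i _ => by ring

/-- Dividing by `j! (n - j)!` made the coefficients symmetric in `i, j`, up to the reindexing `s ↦ i
+ s - j`. With `symEntry_map_star` this yields unitarity later. -/
theorem symEntry_transpose (n i j : ℕ) (hi : i ≤ n) (g : Matrix (Fin 2) (Fin 2) ℂ) :
    symEntry n i j g.transpose = symEntry n j i g := by
  unfold symEntry
  refine Finset.sum_bij' (fun s _ => i + s - j) (fun s _ => j + s - i) ?_ ?_ ?_ ?_ ?_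
  · intro s h
    simp only [Finset.mem_range, Finset.mem_filter] at h ⊢
    omega
  · intro s h
    simp only [Finset.mem_range, Finset.mem_filter] at h ⊢
    omega
  · intro s h
    simp only [Finset.mem_range, Finset.mem_filter] at h
    omega
  · intro s h
    simp only [Finset.mem_range, Finset.mem_filter] at h
    omega
  · intro s h
    simp only [Finset.mem_range, Finset.mem_filter] at h
    have e1 : i - (i + s - j) = j - s := by omega
    have e2 : j + (i + s - j) - i = s := by omega
    have e3 : n - j - (i + s - j) = n - i - s := by omega
    simp only [Matrix.transpose_apply, e1, e2, e3]
    ring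

theorem symEntry_map_star (n i j : ℕ) (g : Matrix (Fin 2) (Fin 2) ℂ) :
    symEntry n i j (g.map star) = star (symEntry n i j g) := by
  simp [symEntry]

theorem symEntry_neg (n i j : ℕ) (g : Matrix (Fin 2) (Fin 2) ℂ) :
    symEntry n i j (-g) = (-1) ^ n * symEntry n i j g := by
  unfold symEntry
  rw [Finset.mul_sum]
  refine Finset.sum_congr rfl fun s h => ?_
  simp only [Finset.mem_range, Finset.mem_filter] at h
  have e : (-1 : ℂ) ^ n =
      (-1) ^ (j - s) * (-1) ^ (i + s - j) * (-1) ^ s * (-1) ^ (n - i - s) := by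
    rw [← pow_add, ← pow_add, ← pow_add]
    congr 1
    omega
  simp only [Matrix.neg_apply, neg_pow (g _ _)]
  rw [e]
  ring

theorem symEntry_diagonal (n i j : ℕ) (hi : i ≤ n) (a d : ℂ) :
    symEntry n i j !![a, 0; 0, d] =
      if i = j then a ^ i * d ^ (n - i) / (i.factorial * (n - i).factorial) else 0 := by
  unfold symEntry
  split_ifs with hij
  · subst hij
    rw [Finset.sum_eq_single 0]
    · simp
    · intro s _ h0
      simp [h0]
    · intro h
      simp at h
      omega
  · refine Finset.sum_eq_zero fun s h => ?_
    simp only [Finset.mem_range, Finset.mem_filter] at h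
    rcases Nat.eq_zero_or_pos s with rfl | h0
    · simp [show i - j ≠ 0 by omega]
    · simp [h0.ne']

theorem symEntry_last (n i : ℕ) (hi : i ≤ n) (g : Matrix (Fin 2) (Fin 2) ℂ) :
    symEntry n i n g = g 0 0 ^ i * g 1 0 ^ (n - i) / (i.factorial * (n - i).factorial) := by
  unfold symEntry
  have : (Finset.range (n + 1)).filter (fun s => s ≤ n ∧ n ≤ i + s ∧ i + s ≤ n) = {n - i} := by
    ext s
    simp only [Finset.mem_range, Finset.mem_filter, Finset.mem_singleton]
    omega
  rw [this, Finset.sum_singleton]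
  have e1 : n - (n - i) = i := by omega
  have e2 : i + (n - i) - n = 0 := by omega
  simp [e1, e2]

/-- The squared norm of the monomial `u ^ i v ^ (n - i)`. -/
noncomputable def symWeight (n i : ℕ) : ℝ := i.factorial * (n - i).factorial

theorem symWeight_pos (n i : ℕ) : 0 < symWeight n i := by
  unfold symWeight
  positivity

/-- The `n`-th symmetric power of a `2 × 2` matrix, in an orthonormal basis of monomials. -/
noncomputable def symRep (n : ℕ) (g : Matrix (Fin 2) (Fin 2) ℂ) :
    Matrix (Fin (n + 1)) (Fin (n + 1)) ℂ :=
  Matrix.of fun i j => ((√(symWeight n i) * √(symWeight n j) : ℝ) : ℂ) * symEntry n i j g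

theorem symRep_apply (n : ℕ) (g : Matrix (Fin 2) (Fin 2) ℂ) (i j : Fin (n + 1)) :
    symRep n g i j = ((√(symWeight n i) * √(symWeight n j) : ℝ) : ℂ) * symEntry n i j g := rfl

theorem symRep_mul (n : ℕ) (g h : Matrix (Fin 2) (Fin 2) ℂ) :
    symRep n (g * h) = symRep n g * symRep n h := by
  ext i j
  rw [Matrix.mul_apply, symRep_apply, symEntry_mul n i j (by omega) (by omega), Finset.mul_sum,
    Finset.sum_range]
  refine Finset.sum_congr rfl fun r _ => ?_
  rw [symRep_apply, symRep_apply]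
  have e : ((r : ℕ).factorial : ℂ) * ((n - r).factorial : ℂ) =
      ((√(symWeight n r) * √(symWeight n r) : ℝ) : ℂ) := by
    rw [Real.mul_self_sqrt (symWeight_pos n r).le, symWeight]
    push_cast
    rfl
  rw [e]
  push_cast
  ring

theorem symRep_conjTranspose (n : ℕ) (g : Matrix (Fin 2) (Fin 2) ℂ) :
    symRep n g.conjTranspose = (symRep n g).conjTranspose := by
  ext i j
  rw [Matrix.conjTranspose_apply, symRep_apply, symRep_apply, Matrix.conjTranspose,
    symEntry_map_star, symEntry_transpose n i j (by omega)]
  simp [mul_comm]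

/-- Only even symmetric powers ignore the sign, which is what lets them descend to `SO(3)`. -/
theorem symRep_neg (m : ℕ) (g : Matrix (Fin 2) (Fin 2) ℂ) :
    symRep (2 * m) (-g) = symRep (2 * m) g := by
  ext i j
  rw [symRep_apply, symRep_apply, symEntry_neg, pow_mul]
  simp

theorem symRep_diagonal (n : ℕ) (a d : ℂ) :
    symRep n !![a, 0; 0, d] = Matrix.diagonal fun i : Fin (n + 1) => a ^ (i : ℕ) * d ^ (n - i) := by
  ext i j
  rw [symRep_apply, symEntry_diagonal n i j (by omega), Matrix.diagonal_apply]
  by_cases h : i = j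
  · subst h
    rw [if_pos rfl, if_pos rfl, Real.mul_self_sqrt (symWeight_pos n i).le, symWeight]
    have f1 := Nat.cast_ne_zero (R := ℂ).2 (Nat.factorial_ne_zero i)
    have f2 := Nat.cast_ne_zero (R := ℂ).2 (Nat.factorial_ne_zero (n - i))
    push_cast
    field_simp
  · rw [if_neg h, if_neg (fun h' => h (Fin.ext h')), mul_zero]

theorem symRep_one (n : ℕ) : symRep n 1 = 1 := by
  rw [Matrix.one_fin_two, symRep_diagonal]
  simp

theorem symRep_last_ne_zero (n : ℕ) (g : Matrix (Fin 2) (Fin 2) ℂ) (h0 : g 0 0 ≠ 0)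
    (h1 : g 1 0 ≠ 0) (i : Fin (n + 1)) : symRep n g i (Fin.last n) ≠ 0 := by
  rw [symRep_apply, Fin.val_last, symEntry_last n i (by omega)]
  have f1 := Nat.cast_ne_zero (R := ℂ).2 (Nat.factorial_ne_zero i)
  have f2 := Nat.cast_ne_zero (R := ℂ).2 (Nat.factorial_ne_zero (n - i))
  have w1 := (Real.sqrt_pos.2 (symWeight_pos n i)).ne'
  have w2 := (Real.sqrt_pos.2 (symWeight_pos n n)).ne'
  refine mul_ne_zero (Complex.ofReal_ne_zero.2 (mul_ne_zero w1 w2)) ?_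
  exact div_ne_zero (mul_ne_zero (pow_ne_zero _ h0) (pow_ne_zero _ h1)) (mul_ne_zero f1 f2)

theorem continuous_symRep (n : ℕ) : Continuous (symRep n) := by
  refine continuous_matrix fun i j => ?_
  simp only [symRep_apply]
  refine continuous_const.mul ?_
  unfold symEntry
  refine continuous_finsetSum _ fun s _ => Continuous.div_const ?_ _
  fun_prop

/-! ### Unit quaternions as the double cover of `SO(3)` -/

open scoped Quaternion

/-- The embedding of the quaternions into the complex `2 × 2` matrices. -/
noncomputable def quatMatrix (q : ℍ[ℝ]) : Matrix (Fin 2) (Fin 2) ℂ :=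
  !![⟨q.re, -q.imK⟩, ⟨-q.imJ, -q.imI⟩; ⟨q.imJ, -q.imI⟩, ⟨q.re, q.imK⟩]

theorem quatMatrix_mul (q r : ℍ[ℝ]) : quatMatrix (q * r) = quatMatrix q * quatMatrix r := by
  ext i j
  fin_cases i <;> fin_cases j <;>
    simp [quatMatrix, Matrix.mul_apply, Fin.sum_univ_two, Complex.ext_iff] <;>
    constructor <;> ring

theorem quatMatrix_star (q : ℍ[ℝ]) : quatMatrix (star q) = (quatMatrix q).conjTranspose := by
  ext i j
  fin_cases i <;> fin_cases j <;> simp [quatMatrix, Complex.ext_iff]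

theorem quatMatrix_neg (q : ℍ[ℝ]) : quatMatrix (-q) = -quatMatrix q := by
  ext i j
  fin_cases i <;> fin_cases j <;> simp [quatMatrix, Complex.ext_iff]

theorem quatMatrix_one : quatMatrix 1 = 1 := by
  ext i j
  fin_cases i <;> fin_cases j <;> simp [quatMatrix, Complex.ext_iff]

/-- The matrix of `v ↦ q v q*` on imaginary quaternions. -/
noncomputable def quatRot (q : ℍ[ℝ]) : Matrix (Fin 3) (Fin 3) ℝ :=
  !![q.re ^ 2 + q.imI ^ 2 - q.imJ ^ 2 - q.imK ^ 2, 2 * (q.imI * q.imJ - q.re * q.imK),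
      2 * (q.imI * q.imK + q.re * q.imJ);
    2 * (q.imI * q.imJ + q.re * q.imK), q.re ^ 2 - q.imI ^ 2 + q.imJ ^ 2 - q.imK ^ 2,
      2 * (q.imJ * q.imK - q.re * q.imI);
    2 * (q.imI * q.imK - q.re * q.imJ), 2 * (q.imJ * q.imK + q.re * q.imI),
      q.re ^ 2 - q.imI ^ 2 - q.imJ ^ 2 + q.imK ^ 2]

theorem quatRot_mul (q r : ℍ[ℝ]) : quatRot (q * r) = quatRot q * quatRot r := by
  ext i j
  fin_cases i <;> fin_cases j <;>
    simp [quatRot, Matrix.mul_apply, Fin.sum_univ_three] <;> ring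

theorem quatRot_star (q : ℍ[ℝ]) : quatRot (star q) = (quatRot q).transpose := by
  ext i j
  fin_cases i <;> fin_cases j <;> simp [quatRot] <;> ring

theorem quatRot_one : quatRot 1 = 1 := by
  ext i j
  fin_cases i <;> fin_cases j <;> simp [quatRot]

theorem star_mul_self_of_normSq {q : ℍ[ℝ]} (hq : Quaternion.normSq q = 1) : star q * q = 1 := by
  rw [Quaternion.star_mul_self, hq, Quaternion.coe_one]

theorem self_mul_star_of_normSq {q : ℍ[ℝ]} (hq : Quaternion.normSq q = 1) : q * star q = 1 := by
  rw [Quaternion.self_mul_star, hq, Quaternion.coe_one]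

/-- The kernel of the cover: subtracting the first two diagonal entries from the norm equation
leaves `imJ² + imK² = 0` and `imI² + imK² = 0`. -/
theorem eq_one_or_eq_neg_one_of_quatRot {q : ℍ[ℝ]} (hq : Quaternion.normSq q = 1)
    (h : quatRot q = 1) : q = 1 ∨ q = -1 := by
  rw [Quaternion.normSq_def'] at hq
  have h0 := congrFun (congrFun h 0) 0
  have h1 := congrFun (congrFun h 1) 1
  simp [quatRot] at h0 h1
  have hi : q.imI = 0 := by nlinarith [sq_nonneg q.imI, sq_nonneg q.imJ, sq_nonneg q.imK]
  have hj : q.imJ = 0 := by nlinarith [sq_nonneg q.imI, sq_nonneg q.imJ, sq_nonneg q.imK]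
  have hk : q.imK = 0 := by nlinarith [sq_nonneg q.imI, sq_nonneg q.imJ, sq_nonneg q.imK]
  have hr : q.re ^ 2 = 1 := by simpa [hi, hj, hk] using hq
  rcases mul_self_eq_one_iff.1 ((sq q.re).symm.trans hr) with h | h
  · left
    ext <;> simp [hi, hj, hk, h]
  · right
    ext <;> simp [hi, hj, hk, h]

theorem eq_or_eq_neg_of_quatRot_eq {q r : ℍ[ℝ]} (hq : Quaternion.normSq q = 1)
    (hr : Quaternion.normSq r = 1) (h : quatRot q = quatRot r) : q = r ∨ q = -r := by
  have h1 : quatRot (q * star r) = 1 := by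
    rw [quatRot_mul, h, ← quatRot_mul, self_mul_star_of_normSq hr, quatRot_one]
  have h2 : Quaternion.normSq (q * star r) = 1 := by
    rw [map_mul, Quaternion.normSq_star, hq, hr, one_mul]
  have h3 : q = q * star r * r := by
    rw [mul_assoc, star_mul_self_of_normSq hr, mul_one]
  rcases eq_one_or_eq_neg_one_of_quatRot h2 h1 with h | h
  · left
    rw [h3, h, one_mul]
  · right
    rw [h3, h, neg_one_mul]

/-- The unit quaternion over `rotZ t`. -/
noncomputable def quatZ (t : ℝ) : ℍ[ℝ] := ⟨Real.cos (t / 2), 0, 0, Real.sin (t / 2)⟩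

/-- The unit quaternion over `rotY t`. -/
noncomputable def quatY (t : ℝ) : ℍ[ℝ] := ⟨Real.cos (t / 2), 0, Real.sin (t / 2), 0⟩

theorem normSq_quatZ (t : ℝ) : Quaternion.normSq (quatZ t) = 1 := by
  rw [Quaternion.normSq_def']
  simp [quatZ]

theorem normSq_quatY (t : ℝ) : Quaternion.normSq (quatY t) = 1 := by
  rw [Quaternion.normSq_def']
  simp [quatY]

/-- The unit quaternion over the rotation with Euler angles `α, β, γ`. -/
noncomputable def eulerQuat (α β γ : ℝ) : ℍ[ℝ] := quatZ α * quatY β * quatZ γ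

theorem normSq_eulerQuat (α β γ : ℝ) : Quaternion.normSq (eulerQuat α β γ) = 1 := by
  simp [eulerQuat, normSq_quatY, normSq_quatZ]

theorem cos_eq_half (t : ℝ) : Real.cos t = Real.cos (t / 2) ^ 2 - Real.sin (t / 2) ^ 2 := by
  rw [← Real.cos_two_mul']
  ring_nf

theorem sin_eq_half (t : ℝ) : Real.sin t = 2 * Real.sin (t / 2) * Real.cos (t / 2) := by
  rw [← Real.sin_two_mul]
  ring_nf

theorem quatRot_quatZ (t : ℝ) : quatRot (quatZ t) = rotZ t := by
  have h1 := cos_eq_half t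
  have h2 := sin_eq_half t
  have h3 := Real.cos_sq_add_sin_sq (t / 2)
  ext i j
  fin_cases i <;> fin_cases j <;> simp [quatRot, quatZ, rotZ] <;> linarith

theorem quatRot_quatY (t : ℝ) : quatRot (quatY t) = rotY t := by
  have h1 := cos_eq_half t
  have h2 := sin_eq_half t
  have h3 := Real.cos_sq_add_sin_sq (t / 2)
  ext i j
  fin_cases i <;> fin_cases j <;> simp [quatRot, quatY, rotY] <;> linarith

theorem quatRot_eulerQuat (α β γ : ℝ) :
    quatRot (eulerQuat α β γ) = rotZ α * rotY β * rotZ γ := by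
  rw [eulerQuat, quatRot_mul, quatRot_mul, quatRot_quatZ, quatRot_quatZ, quatRot_quatY]

theorem exists_quat (x : SO3) : ∃ q : ℍ[ℝ], Quaternion.normSq q = 1 ∧ quatRot q = x.1 := by
  obtain ⟨e, _, he⟩ := exists_eulerAngles x
  exact ⟨eulerQuat e.1 e.2.1 e.2.2, normSq_eulerQuat _ _ _, by rw [quatRot_eulerQuat, he]⟩

/-! ### The Wigner functions as a continuous unitary representation -/

/-- With `i = m + k` and `j = m + l` the two sums agree term by term. The sign `(-1)^(k-l+s)` comes
from the entry `-sin (β / 2)`, which occurs to the power `i + s - j`. -/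
theorem smallD_eq_symRep (m : ℕ) (i j : Fin (2 * m + 1)) (β : ℝ) :
    (smallD m ((i : ℤ) - m) ((j : ℤ) - m) β : ℂ) =
      symRep (2 * m) (quatMatrix (quatY β)) i j := by
  have hi := i.2
  have hj := j.2
  have c0 : ∀ r : ℝ, (⟨r, 0⟩ : ℂ) = (r : ℂ) := fun r => rfl
  rw [symRep_apply, smallD]
  have w : ∀ i : Fin (2 * m + 1), ((m + ((i : ℤ) - m)).toNat.factorial : ℝ) *
      ((m - ((i : ℤ) - m)).toNat.factorial : ℝ) = symWeight (2 * m) i := by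
    intro i
    have hi := i.2
    rw [symWeight, show (m + ((i : ℤ) - m)).toNat = i by omega,
      show (m - ((i : ℤ) - m)).toNat = 2 * m - i by omega]
  rw [w i, mul_assoc (symWeight _ _), w j, Real.sqrt_mul (symWeight_pos _ _).le,
    Complex.ofReal_mul, symEntry]
  congr 1
  push_cast
  refine Finset.sum_congr ?_ fun s hs => ?_
  · ext s
    simp only [Finset.mem_filter, Finset.mem_range]
    omega
  · simp only [Finset.mem_filter, Finset.mem_range] at hs
    rw [show (m + ((j : ℤ) - m) - s).toNat = j - s by omega,
      show ((i : ℤ) - m - ((j : ℤ) - m) + s).toNat = i + s - j by omega,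
      show (m - ((i : ℤ) - m) - s).toNat = 2 * m - i - s by omega,
      show (2 * m + ((j : ℤ) - m) - ((i : ℤ) - m) - 2 * s).toNat =
        (j - s) + (2 * m - i - s) by omega,
      show ((i : ℤ) - m - ((j : ℤ) - m) + 2 * s).toNat = (i + s - j) + s by omega]
    simp only [quatMatrix, quatY, Matrix.of_apply, Matrix.cons_val', Matrix.cons_val_zero,
      Matrix.cons_val_one, Matrix.cons_val_fin_one, neg_zero, c0]
    rw [pow_add, pow_add]
    push_cast
    rw [neg_pow (Complex.sin _)]
    ring

theorem quatMatrix_rotZ (t : ℝ) : quatMatrix (quatZ t) =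
    !![Complex.exp (-(t / 2 * Complex.I)), 0; 0, Complex.exp (t / 2 * Complex.I)] := by
  have h1 : Complex.exp (t / 2 * Complex.I) = ⟨Real.cos (t / 2), Real.sin (t / 2)⟩ := by
    rw [Complex.exp_mul_I]
    apply Complex.ext <;>
      simp [← Complex.ofReal_ofNat, ← Complex.ofReal_div, ← Complex.ofReal_cos, ← Complex.ofReal_sin]
  have h2 : Complex.exp (-(t / 2 * Complex.I)) = ⟨Real.cos (t / 2), -Real.sin (t / 2)⟩ := by
    rw [← neg_mul, Complex.exp_mul_I, Complex.cos_neg, Complex.sin_neg]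
    apply Complex.ext <;>
      simp [← Complex.ofReal_ofNat, ← Complex.ofReal_div, ← Complex.ofReal_cos, ← Complex.ofReal_sin]
  rw [h1, h2]
  ext i j
  fin_cases i <;> fin_cases j <;> simp [quatMatrix, quatZ, Complex.ext_iff]

theorem symRep_quatMatrix_rotZ (m : ℕ) (t : ℝ) :
    symRep (2 * m) (quatMatrix (quatZ t)) =
      Matrix.diagonal fun i : Fin (2 * m + 1) =>
        Complex.exp (-Complex.I * (((i : ℤ) - m : ℤ) : ℂ) * t) := by
  rw [quatMatrix_rotZ, symRep_diagonal]
  congr 1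
  ext i
  have hi := i.2
  rw [← Complex.exp_nat_mul, ← Complex.exp_nat_mul, ← Complex.exp_add, Nat.cast_sub (by omega)]
  congr 1
  push_cast
  ring

/-- The unitary representation of `SO(3)` of dimension `2m+1` with matrix entries
`D^m_{k,l} / √(2m+1)`. -/
noncomputable def wignerRep (m : ℕ) (x : SO3) : Matrix (Fin (2 * m + 1)) (Fin (2 * m + 1)) ℂ :=
  Matrix.of fun i j => wignerD m ((i : ℤ) - m) ((j : ℤ) - m) x / (√(2 * m + 1) : ℝ)

theorem wignerD_eq_wignerRep (m : ℕ) (x : SO3) (i j : Fin (2 * m + 1)) :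
    wignerD m ((i : ℤ) - m) ((j : ℤ) - m) x = (√(2 * m + 1) : ℝ) * wignerRep m x i j := by
  have : ((√(2 * m + 1) : ℝ) : ℂ) ≠ 0 := Complex.ofReal_ne_zero.2 (by positivity)
  rw [wignerRep, Matrix.of_apply]
  field_simp

/-- Any lift may be used, since two lifts differ by a sign. Multiplicativity, unitarity and
continuity thereby become statements about quaternions instead of Euler angles. -/
theorem wignerRep_eq_symRep (m : ℕ) {x : SO3} {q : ℍ[ℝ]} (hq : Quaternion.normSq q = 1)
    (hx : quatRot q = x.1) : wignerRep m x = symRep (2 * m) (quatMatrix q) := by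
  obtain ⟨e, he⟩ := exists_eulerAngles x
  have h1 : wignerRep m x = symRep (2 * m) (quatMatrix (eulerQuat e.1 e.2.1 e.2.2)) := by
    rw [eulerQuat, quatMatrix_mul, quatMatrix_mul, symRep_mul, symRep_mul, symRep_quatMatrix_rotZ,
      symRep_quatMatrix_rotZ]
    ext i j
    rw [Matrix.mul_diagonal, Matrix.diagonal_mul, ← smallD_eq_symRep]
    have h0 : ((√(2 * m + 1) : ℝ) : ℂ) ≠ 0 := Complex.ofReal_ne_zero.2 (by positivity)
    rw [wignerRep, Matrix.of_apply, wignerD_eq he, eulerD]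
    field_simp
  have h2 : quatRot q = quatRot (eulerQuat e.1 e.2.1 e.2.2) := by
    rw [hx, quatRot_eulerQuat, he.2]
  rcases eq_or_eq_neg_of_quatRot_eq hq (normSq_eulerQuat _ _ _) h2 with h | h
  · rw [h1, h]
  · rw [h1, h, quatMatrix_neg, symRep_neg]

theorem wignerRep_mul (m : ℕ) (x y : SO3) :
    wignerRep m (x * y) = wignerRep m x * wignerRep m y := by
  obtain ⟨q, hq, hx⟩ := exists_quat x
  obtain ⟨r, hr, hy⟩ := exists_quat y
  have h : quatRot (q * r) = (x * y).1 := by rw [quatRot_mul, hx, hy]; rfl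
  rw [wignerRep_eq_symRep m hq hx, wignerRep_eq_symRep m hr hy,
    wignerRep_eq_symRep m (by rw [map_mul, hq, hr, one_mul]) h, quatMatrix_mul, symRep_mul]

theorem wignerRep_one (m : ℕ) : wignerRep m 1 = 1 := by
  rw [wignerRep_eq_symRep m (q := 1) (by simp) (by rw [quatRot_one]; rfl), quatMatrix_one,
    symRep_one]

theorem wignerRep_inv (m : ℕ) (x : SO3) : wignerRep m x⁻¹ = (wignerRep m x).conjTranspose := by
  obtain ⟨q, hq, hx⟩ := exists_quat x
  have h : quatRot (star q) = (x⁻¹).1 := by rw [quatRot_star, hx]; rfl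
  rw [wignerRep_eq_symRep m hq hx, wignerRep_eq_symRep m (by rwa [Quaternion.normSq_star]) h,
    quatMatrix_star, symRep_conjTranspose]

theorem wignerRep_mul_conjTranspose (m : ℕ) (x : SO3) :
    wignerRep m x * (wignerRep m x).conjTranspose = 1 := by
  rw [← wignerRep_inv, ← wignerRep_mul, mul_inv_cancel, wignerRep_one]

theorem continuous_quatMatrix : Continuous quatMatrix := by
  have h1 := Quaternion.continuous_re
  have h2 := Quaternion.continuous_imI
  have h3 := Quaternion.continuous_imJ
  have h4 := Quaternion.continuous_imK
  refine continuous_matrix fun i j => ?_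
  have hc : ∀ f g : ℍ[ℝ] → ℝ, Continuous f → Continuous g →
      Continuous fun q => (⟨f q, g q⟩ : ℂ) := fun f g hf hg =>
    Complex.equivRealProdCLM.symm.continuous.comp (hf.prodMk hg)
  fin_cases i <;> fin_cases j
  · exact hc _ _ h1 h4.neg
  · exact hc _ _ h3.neg h2.neg
  · exact hc _ _ h3 h2.neg
  · exact hc _ _ h1 h4

theorem continuous_quatRot : Continuous quatRot := by
  have h1 := Quaternion.continuous_re
  have h2 := Quaternion.continuous_imI
  have h3 := Quaternion.continuous_imJ
  have h4 := Quaternion.continuous_imK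
  refine continuous_matrix fun i j => ?_
  fin_cases i <;> fin_cases j <;> simp [quatRot] <;> fun_prop

theorem quatRot_mem {q : ℍ[ℝ]} (hq : ‖q‖ = 1) :
    quatRot q ∈ Matrix.specialOrthogonalGroup (Fin 3) ℝ := by
  have hq' : Quaternion.normSq q = 1 := by
    rw [Quaternion.normSq_eq_norm_mul_self, hq, one_mul]
  refine mem_SO3_iff.2 ⟨?_, ?_⟩
  · rw [← quatRot_star, ← quatRot_mul, star_mul_self_of_normSq hq', quatRot_one]
  · have h : (quatRot q).det = Quaternion.normSq q ^ 3 := by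
      rw [Quaternion.normSq_def', Matrix.det_fin_three]
      simp [quatRot]
      ring
    rw [h, hq', one_pow]

/-- The chosen Euler angles need not vary continuously, so continuity is descended from the 3-sphere
of unit quaternions: its map onto `SO(3)` is a quotient map, being continuous, surjective and closed
by compactness. -/
theorem continuous_wignerRep (m : ℕ) : Continuous (wignerRep m) := by
  have : ProperSpace ℍ[ℝ] := FiniteDimensional.proper ℝ _
  let φ : Metric.sphere (0 : ℍ[ℝ]) 1 → SO3 := fun q =>
    ⟨quatRot q.1, quatRot_mem (mem_sphere_zero_iff_norm.1 q.2)⟩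
  have hn : ∀ q : Metric.sphere (0 : ℍ[ℝ]) 1, Quaternion.normSq q.1 = 1 := fun q => by
    rw [Quaternion.normSq_eq_norm_mul_self, mem_sphere_zero_iff_norm.1 q.2, one_mul]
  have hφ : Continuous φ :=
    (continuous_quatRot.comp continuous_subtype_val).subtype_mk _
  have hs : Function.Surjective φ := fun x => by
    obtain ⟨q, hq, hx⟩ := exists_quat x
    refine ⟨⟨q, ?_⟩, Subtype.ext hx⟩
    rw [mem_sphere_zero_iff_norm]
    rw [Quaternion.normSq_eq_norm_mul_self] at hq
    nlinarith [norm_nonneg q]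
  have hquot := hφ.isClosedMap.isQuotientMap hφ hs
  rw [hquot.continuous_iff]
  have : wignerRep m ∘ φ = fun q => symRep (2 * m) (quatMatrix q.1) := by
    ext1 q
    exact wignerRep_eq_symRep m (hn q) rfl
  rw [this]
  exact (continuous_symRep _).comp (continuous_quatMatrix.comp continuous_subtype_val)

/-! ### Irreducibility -/

/-- The rotation about the `z`-axis by the angle `t`, as an element of `SO(3)`. -/
noncomputable def zRot (t : ℝ) : SO3 := ⟨rotZ t, rotZ_mem t⟩

/-- The rotation about the `y`-axis by the angle `t`, as an element of `SO(3)`. -/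
noncomputable def yRot (t : ℝ) : SO3 := ⟨rotY t, rotY_mem t⟩

theorem wignerRep_zRot (m : ℕ) (t : ℝ) :
    wignerRep m (zRot t) = Matrix.diagonal fun i : Fin (2 * m + 1) =>
      Complex.exp (-Complex.I * (((i : ℤ) - m : ℤ) : ℂ) * t) := by
  rw [wignerRep_eq_symRep m (normSq_quatZ t) (quatRot_quatZ t), symRep_quatMatrix_rotZ]

/-- At the angle `1 / (2m + 1)` any two phases differ by less than `1 < 2π`, so no wrap-around can
identify them. -/
theorem exp_ne_exp {m : ℕ} {i j : Fin (2 * m + 1)} (h : i ≠ j) :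
    Complex.exp (-Complex.I * (((i : ℤ) - m : ℤ) : ℂ) * ((1 / (2 * m + 1) : ℝ) : ℂ)) ≠
      Complex.exp (-Complex.I * (((j : ℤ) - m : ℤ) : ℂ) * ((1 / (2 * m + 1) : ℝ) : ℂ)) := by
  intro he
  obtain ⟨n, hn⟩ := Complex.exp_eq_exp_iff_exists_int.1 he
  have him := congrArg Complex.im hn
  have hm : (0 : ℝ) < 2 * m + 1 := by positivity
  have hi : ((i : ℕ) : ℝ) < 2 * m + 1 := by exact_mod_cast i.2
  have hj : ((j : ℕ) : ℝ) < 2 * m + 1 := by exact_mod_cast j.2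
  have hi0 : (0 : ℝ) ≤ ((i : ℕ) : ℝ) := Nat.cast_nonneg _
  have hj0 : (0 : ℝ) ≤ ((j : ℕ) : ℝ) := Nat.cast_nonneg _
  have key : ((j : ℕ) : ℝ) - ((i : ℕ) : ℝ) = n * (2 * Real.pi) * (2 * m + 1) := by
    have h1 : (-Complex.I * (((i : ℤ) - m : ℤ) : ℂ) * ((1 / (2 * m + 1) : ℝ) : ℂ)).im =
        -(((i : ℕ) : ℝ) - m) / (2 * m + 1) := by
      rw [Complex.im_mul_ofReal]
      simp
      ring
    have h2 : (-Complex.I * (((j : ℤ) - m : ℤ) : ℂ) * ((1 / (2 * m + 1) : ℝ) : ℂ)).im =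
        -(((j : ℕ) : ℝ) - m) / (2 * m + 1) := by
      rw [Complex.im_mul_ofReal]
      simp
      ring
    rw [Complex.add_im, h1, h2] at him
    have h3 : ((n : ℂ) * (2 * (Real.pi : ℂ) * Complex.I)).im = n * (2 * Real.pi) := by simp
    rw [h3] at him
    field_simp at him
    linarith
  have hpi := Real.pi_gt_three
  have hn0 : n = 0 := by
    by_contra hne
    have : (1 : ℝ) ≤ |(n : ℝ)| := by exact_mod_cast Int.one_le_abs hne
    have h2 : |((j : ℕ) : ℝ) - ((i : ℕ) : ℝ)| < 2 * m + 1 := by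
      rw [abs_lt]
      constructor <;> linarith
    rw [key, abs_mul, abs_mul, abs_of_pos hm, abs_of_pos (by positivity : 0 < 2 * Real.pi)] at h2
    have h3 : 1 ≤ |(n : ℝ)| * (2 * Real.pi) := by nlinarith
    nlinarith
  rw [hn0] at key
  simp only [Int.cast_zero, zero_mul] at key
  apply h
  ext
  have : ((j : ℕ) : ℝ) = ((i : ℕ) : ℝ) := by linarith
  exact_mod_cast this.symm

/-- Schur's lemma for `wignerRep`. -/
theorem eq_smul_one_of_commute {m : ℕ} {A : Matrix (Fin (2 * m + 1)) (Fin (2 * m + 1)) ℂ}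
    (h : ∀ x, A * wignerRep m x = wignerRep m x * A) :
    ∃ c : ℂ, A = c • (1 : Matrix (Fin (2 * m + 1)) (Fin (2 * m + 1)) ℂ) := by
  -- Commuting with a diagonal matrix with distinct entries forces `A` to be diagonal.
  have hoff : ∀ i j, i ≠ j → A i j = 0 := by
    intro i j hij
    have := congrFun (congrFun (h (zRot (1 / (2 * m + 1)))) i) j
    rw [wignerRep_zRot, Matrix.mul_diagonal, Matrix.diagonal_mul, mul_comm, ← sub_eq_zero,
      ← sub_mul] at this
    exact (mul_eq_zero.1 this).resolve_left (sub_ne_zero.2 (exp_ne_exp hij.symm))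
  have hdiag : A = Matrix.diagonal fun i => A i i := by
    ext i j
    rw [Matrix.diagonal_apply]
    split_ifs with hij
    · rw [hij]
    · exact hoff i j hij
  refine ⟨A (Fin.last _) (Fin.last _), ?_⟩
  rw [Matrix.smul_one_eq_diagonal, hdiag]
  congr 1
  ext i
  -- The last column of `wignerRep m (yRot 1)` has no zero entry: it is a multiple of products of
  -- powers of `cos (1/2)` and `sin (1/2)`. Hence every diagonal entry of `A` equals the last one.
  have := congrFun (congrFun (h (yRot 1)) i) (Fin.last _)
  rw [hdiag, Matrix.mul_diagonal, Matrix.diagonal_mul, mul_comm] at this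
  rw [Matrix.diagonal_apply_eq]
  refine mul_left_cancel₀ ?_ this
  rw [wignerRep_eq_symRep m (normSq_quatY 1) (quatRot_quatY 1)]
  refine symRep_last_ne_zero _ _ ?_ ?_ i
  · intro h0
    have := congrArg Complex.re h0
    have hc : 0 < Real.cos (1 / 2) := Real.cos_pos_of_mem_Ioo
      ⟨by linarith [Real.pi_gt_three], by linarith [Real.pi_gt_three]⟩
    simp [quatMatrix, quatY] at this
    norm_num at hc
    linarith
  · intro h0
    have := congrArg Complex.re h0
    have hc : 0 < Real.sin (1 / 2) := Real.sin_pos_of_pos_of_lt_pi (by norm_num)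
      (by linarith [Real.pi_gt_three])
    simp [quatMatrix, quatY] at this
    norm_num at hc
    linarith

/-! ### Rotation axes, conjugacy classes and characters -/

/-- Euler's rotation theorem. From `x - 1 = -x (x - 1)ᵀ` in odd dimension, `det (x - 1)` equals its
own negative. -/
theorem exists_mulVec_eq_self (x : SO3) : ∃ v : Fin 3 → ℝ, v ≠ 0 ∧ x.1.mulVec v = v := by
  have hdet : (x.1 - 1).det = 0 := by
    have h1 : x.1 - 1 = -(x.1 * (x.1 - 1).transpose) := by
      have h2 : x.1 * x.1.transpose = 1 := mul_eq_one_comm.1 (transpose_mul_self x)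
      rw [Matrix.transpose_sub, mul_sub, h2]
      simp
    have h3 := congrArg Matrix.det h1
    rw [Matrix.det_neg, Matrix.det_mul, Matrix.det_transpose, det_eq_one] at h3
    norm_num at h3
    linarith
  obtain ⟨v, hv, h⟩ := Matrix.exists_mulVec_eq_zero_iff.2 hdet
  refine ⟨v, hv, ?_⟩
  rwa [Matrix.sub_mulVec, Matrix.one_mulVec, sub_eq_zero] at h

theorem exists_rotZ_mul_rotY_mulVec (v : Fin 3 → ℝ) : ∃ α β r : ℝ,
    v = r • (rotZ α * rotY β).mulVec ![0, 0, 1] := by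
  obtain ⟨α, h0, h1⟩ := exists_polar (v 0) (v 1)
  obtain ⟨β, h2, h3⟩ := exists_polar (v 2) (√(v 0 ^ 2 + v 1 ^ 2))
  refine ⟨α, β, √(v 2 ^ 2 + √(v 0 ^ 2 + v 1 ^ 2) ^ 2), ?_⟩
  set r := √(v 2 ^ 2 + √(v 0 ^ 2 + v 1 ^ 2) ^ 2)
  set s := √(v 0 ^ 2 + v 1 ^ 2)
  ext i
  fin_cases i
  · simp [rotZ, rotY]
    rw [h0, h3]
    ring
  · simp [rotZ, rotY]
    rw [h1, h3]
    ring
  · simp [rotZ, rotY]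
    exact h2

/-- Carry the `z`-axis to the axis of `x` by spherical coordinates; the conjugated rotation then
fixes the `z`-axis. -/
theorem exists_conj_zRot (x : SO3) : ∃ (y : SO3) (t : ℝ), x = y * zRot t * y⁻¹ := by
  obtain ⟨v, hv, hxv⟩ := exists_mulVec_eq_self x
  obtain ⟨α, β, r, hr⟩ := exists_rotZ_mul_rotY_mulVec v
  have hr0 : r ≠ 0 := by
    rintro rfl
    exact hv (by rw [hr, zero_smul])
  set y : SO3 := zRot α * yRot β with hy
  have hfix : x.1.mulVec (y.1.mulVec ![0, 0, 1]) = y.1.mulVec ![0, 0, 1] := by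
    have hyv : v = r • y.1.mulVec ![0, 0, 1] := hr
    rw [hyv, Matrix.mulVec_smul] at hxv
    exact smul_right_injective _ hr0 hxv
  have hz : (y⁻¹ * x * y).1.mulVec ![0, 0, 1] = ![0, 0, 1] := by
    have e : (y⁻¹ * x * y).1 = y.1.transpose * x.1 * y.1 := rfl
    rw [e, ← Matrix.mulVec_mulVec, ← Matrix.mulVec_mulVec, hfix, Matrix.mulVec_mulVec,
      transpose_mul_self, Matrix.one_mulVec]
  have hcol : ∀ i, (y⁻¹ * x * y).1 i 2 = (![0, 0, 1] : Fin 3 → ℝ) i := fun i => by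
    have := congrFun hz i
    simpa [Matrix.mulVec, dotProduct, Fin.sum_univ_three] using this
  obtain ⟨t, ht⟩ := eq_rotZ_of_fix (y⁻¹ * x * y) (hcol 0) (hcol 1) (hcol 2)
  refine ⟨y, t, ?_⟩
  have : zRot t = y⁻¹ * x * y := Subtype.ext ht.symm
  rw [this]
  group

/-- `sin² (ω / 2)` for a rotation by the angle `ω`. -/
noncomputable def sinSqHalf (x : SO3) : ℝ := (3 - x.1.trace) / 4

theorem sinSqHalf_mul_comm (x y : SO3) : sinSqHalf (x * y) = sinSqHalf (y * x) := by
  unfold sinSqHalf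
  rw [show (x * y).1 = x.1 * y.1 from rfl, Matrix.trace_mul_comm]
  rfl

theorem sinSqHalf_zRot (t : ℝ) : sinSqHalf (zRot t) = (1 - Real.cos t) / 2 := by
  simp [sinSqHalf, zRot, rotZ, Matrix.trace, Fin.sum_univ_three]
  ring

theorem sinSqHalf_conj (x y : SO3) : sinSqHalf (y * x * y⁻¹) = sinSqHalf x := by
  rw [sinSqHalf_mul_comm]
  group

theorem sinSqHalf_mem (x : SO3) : sinSqHalf x ∈ Set.Icc (0 : ℝ) 1 := by
  obtain ⟨y, t, rfl⟩ := exists_conj_zRot x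
  rw [sinSqHalf_conj, sinSqHalf_zRot]
  constructor <;> linarith [Real.cos_le_one t, Real.neg_one_le_cos t]

theorem continuous_sinSqHalf : Continuous sinSqHalf := by
  unfold sinSqHalf
  exact (continuous_const.sub continuous_subtype_val.matrix_trace).div_const _

/-- The polynomials expressing the characters of `SO(3)` in terms of `sin² (ω / 2)`. -/
noncomputable def charPoly : ℕ → Polynomial ℝ
  | 0 => 1
  | 1 => 3 - 4 * Polynomial.X
  | m + 2 => (2 - 4 * Polynomial.X) * charPoly (m + 1) - charPoly m

/-- For `v, w = e^{∓iω}` the right side is the Dirichlet kernel. Since `2 - 4t = v + w`, the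
recurrence of `charPoly` is multiplication of that kernel by `v + w`. -/
theorem charPoly_eval_cos (m : ℕ) {v w : ℂ} (hvw : v * w = 1) {t : ℝ}
    (ht : (t : ℂ) = (2 - v - w) / 4) :
    (((charPoly m).eval t : ℝ) : ℂ) =
      1 + ∑ k ∈ Finset.range m, (v ^ (k + 1) + w ^ (k + 1)) := by
  have key : ∀ m : ℕ, (v + w) * (1 + ∑ k ∈ Finset.range (m + 1), (v ^ (k + 1) + w ^ (k + 1))) =
      (1 + ∑ k ∈ Finset.range (m + 2), (v ^ (k + 1) + w ^ (k + 1))) +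
        (1 + ∑ k ∈ Finset.range m, (v ^ (k + 1) + w ^ (k + 1))) := by
    intro m
    induction m with
    | zero =>
      simp [Finset.sum_range_succ]
      linear_combination 2 * hvw
    | succ m ih =>
      rw [Finset.sum_range_succ, ← add_assoc, mul_add, ih, Finset.sum_range_succ _ (m + 2),
        Finset.sum_range_succ _ m]
      linear_combination (v ^ (m + 1) + w ^ (m + 1)) * hvw
  induction m using Nat.twoStepInduction with
  | zero => simp [charPoly]
  | one =>
    simp [charPoly, ht]
    ring
  | more m ih1 ih2 =>
    have := key m
    rw [← ih1, ← ih2] at this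
    have e : (charPoly (m + 2)).eval t =
        (2 - 4 * t) * (charPoly (m + 1)).eval t - (charPoly m).eval t := by
      simp [charPoly]
    rw [e]
    push_cast
    rw [ht]
    linear_combination this

theorem trace_wignerRep (m : ℕ) (x : SO3) :
    (wignerRep m x).trace = (((charPoly m).eval (sinSqHalf x) : ℝ) : ℂ) := by
  obtain ⟨y, t, rfl⟩ := exists_conj_zRot x
  rw [sinSqHalf_conj, wignerRep_mul, wignerRep_mul, mul_assoc, Matrix.trace_mul_comm, mul_assoc,
    ← wignerRep_mul, inv_mul_cancel, wignerRep_one, mul_one, wignerRep_zRot, Matrix.trace_diagonal,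
    sinSqHalf_zRot]
  have h1 : Complex.exp (-Complex.I * t) * Complex.exp (Complex.I * t) = 1 := by
    rw [← Complex.exp_add]
    simp
  rw [charPoly_eval_cos m h1]
  · rw [Fin.sum_univ_eq_sum_range
      (fun i => Complex.exp (-Complex.I * (((i : ℤ) - m : ℤ) : ℂ) * t))]
    induction m with
    | zero => simp
    | succ m ih =>
      -- Passing from `m` to `m + 1` adds just the two extreme weights `±(m + 1)`; the middle terms
      -- are shifted by one index.
      rw [show 2 * (m + 1) + 1 = 2 * m + 1 + 1 + 1 by ring, Finset.sum_range_succ,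
        Finset.sum_range_succ', Finset.sum_range_succ _ m, ← add_assoc, ← ih, ← Complex.exp_nat_mul,
        ← Complex.exp_nat_mul]
      have e1 : ∀ k ∈ Finset.range (2 * m + 1),
          Complex.exp (-Complex.I * ((((k + 1 : ℕ) : ℤ) - (m + 1 : ℕ) : ℤ) : ℂ) * t) =
          Complex.exp (-Complex.I * (((k : ℤ) - m : ℤ) : ℂ) * t) := fun k _ => by
        congr 3
        push_cast
        ring
      rw [Finset.sum_congr rfl e1, add_assoc]
      congr 1
      rw [add_comm]
      congr 1 <;> congr 1 <;> push_cast <;> ring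
  · push_cast
    rw [Complex.cos]
    rw [show -Complex.I * (t : ℂ) = -(t : ℂ) * Complex.I by ring, mul_comm Complex.I]
    ring

/-! ### Haar integration and central functions -/

instance : SecondCountableTopology (Matrix (Fin 3) (Fin 3) ℝ) :=
  inferInstanceAs (SecondCountableTopology (Fin 3 → Fin 3 → ℝ))

instance : SecondCountableTopology SO3 :=
  TopologicalSpace.Subtype.secondCountableTopology _

instance : haarSO3.IsHaarMeasure := by
  unfold haarSO3
  infer_instance

instance : IsProbabilityMeasure haarSO3 where
  measure_univ := by
    unfold haarSO3
    simpa using Measure.haarMeasure_self (G := SO3) (K₀ := ⊤)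

/-- A right translate of Haar measure is again a left Haar probability measure, and there is only
one. -/
instance : haarSO3.IsMulRightInvariant where
  map_mul_right_eq_self g := by
    have := Measure.isProbabilityMeasure_map (μ := haarSO3) (measurable_mul_const g).aemeasurable
    exact Measure.isHaarMeasure_eq_of_isProbabilityMeasure _ _

theorem integrable_of_continuous {f : SO3 → ℂ} (hf : Continuous f) : Integrable f haarSO3 :=
  hf.integrable_of_hasCompactSupport (HasCompactSupport.of_compactSpace f)

theorem continuous_wignerRep_apply (m : ℕ) (i j : Fin (2 * m + 1)) :
    Continuous fun x => wignerRep m x i j :=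
  (continuous_wignerRep m).matrix_elem i j

theorem Integrable.mul_continuous {f g : SO3 → ℂ} (hf : Integrable f haarSO3)
    (hg : Continuous g) : Integrable (fun x => f x * g x) haarSO3 := by
  obtain ⟨C, hC⟩ := isCompact_univ.exists_bound_of_continuousOn hg.continuousOn
  exact hf.mul_bdd hg.aestronglyMeasurable (ae_of_all _ fun x => hC x (Set.mem_univ x))

/-- The Fourier transform of `f` at the representation `wignerRep m`. -/
noncomputable def wignerIntegral (m : ℕ) (f : SO3 → ℂ) :
    Matrix (Fin (2 * m + 1)) (Fin (2 * m + 1)) ℂ :=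
  Matrix.of fun i j => ∫ x, f x * wignerRep m x i j ∂haarSO3

theorem wignerIntegral_mul (m : ℕ) {f : SO3 → ℂ} (hf : Integrable f haarSO3) (g : SO3) :
    wignerIntegral m f * wignerRep m g = wignerIntegral m fun x => f (x * g⁻¹) := by
  ext i j
  rw [Matrix.mul_apply]
  simp only [wignerIntegral, Matrix.of_apply]
  rw [← integral_mul_right_eq_self _ g]
  simp only [mul_inv_cancel_right, wignerRep_mul, Matrix.mul_apply, Finset.mul_sum, ← mul_assoc]
  rw [integral_finsetSum _ fun k _ =>
    (Integrable.mul_continuous hf (continuous_wignerRep_apply m i k)).mul_const _]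
  simp_rw [integral_mul_const]

theorem mul_wignerIntegral (m : ℕ) {f : SO3 → ℂ} (hf : Integrable f haarSO3) (g : SO3) :
    wignerRep m g * wignerIntegral m f = wignerIntegral m fun x => f (g⁻¹ * x) := by
  ext i j
  rw [Matrix.mul_apply]
  simp only [wignerIntegral, Matrix.of_apply]
  rw [← integral_mul_left_eq_self _ g]
  simp only [inv_mul_cancel_left, wignerRep_mul, Matrix.mul_apply, Finset.mul_sum,
    mul_left_comm (f _)]
  rw [integral_finsetSum _ fun k _ =>
    (Integrable.mul_continuous hf (continuous_wignerRep_apply m k j)).const_mul _]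
  simp_rw [integral_const_mul]

theorem smul_one_trace (m : ℕ) (c : ℂ) :
    (c • (1 : Matrix (Fin (2 * m + 1)) (Fin (2 * m + 1)) ℂ)).trace = c * (2 * m + 1) := by
  rw [Matrix.trace_smul, Matrix.trace_one, Fintype.card_fin, smul_eq_mul]
  push_cast
  rfl

theorem trace_wignerIntegral (m : ℕ) {f : SO3 → ℂ} (hf : Integrable f haarSO3) :
    (wignerIntegral m f).trace =
      ∫ x, f x * (((charPoly m).eval (sinSqHalf x) : ℝ) : ℂ) ∂haarSO3 := by
  simp only [Matrix.trace, Matrix.diag, wignerIntegral, Matrix.of_apply, ← trace_wignerRep,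
    Finset.mul_sum]
  rw [integral_finsetSum _ fun k _ =>
    Integrable.mul_continuous hf (continuous_wignerRep_apply m k k)]

/-- For central `f` the left and right translation formulas coincide, so Schur's lemma makes the
transform scalar; its trace identifies the scalar. -/
theorem wignerIntegral_central (m : ℕ) {f : SO3 → ℂ} (hf : Integrable f haarSO3)
    (hc : ∀ x y, f (x * y) = f (y * x)) :
    wignerIntegral m f =
      ((∫ x, f x * (((charPoly m).eval (sinSqHalf x) : ℝ) : ℂ) ∂haarSO3) / (2 * m + 1)) •
        (1 : Matrix (Fin (2 * m + 1)) (Fin (2 * m + 1)) ℂ) := by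
  obtain ⟨c, h⟩ := eq_smul_one_of_commute (A := wignerIntegral m f) fun g => by
    rw [wignerIntegral_mul m hf, mul_wignerIntegral m hf]
    simp_rw [hc _ g⁻¹]
  have hm : (2 * m + 1 : ℂ) ≠ 0 := by exact_mod_cast (2 * m).succ_ne_zero
  have htr := congrArg Matrix.trace h
  rw [smul_one_trace, trace_wignerIntegral m hf] at htr
  rw [htr, mul_div_cancel_right₀ _ hm]
  exact h

/-- The transform of the constant `1` is a scalar `c` unchanged by multiplication with any
`wignerRep m g`. For `m ≠ 0` some `wignerRep m g` has a diagonal entry different from `1`, so `c =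
0`. -/
theorem integral_charPoly (m : ℕ) :
    ∫ x, (charPoly m).eval (sinSqHalf x) ∂haarSO3 = if m = 0 then 1 else 0 := by
  split_ifs with h0
  · subst h0
    simp [charPoly]
  · have hf : Integrable (fun _ : SO3 => (1 : ℂ)) haarSO3 := integrable_const _
    have h1 := wignerIntegral_central m hf fun _ _ => rfl
    simp only [one_mul, integral_complex_ofReal] at h1
    set c : ℂ := (↑(∫ x, (charPoly m).eval (sinSqHalf x) ∂haarSO3) : ℂ) / (2 * m + 1) with hc
    have h2 := mul_wignerIntegral m hf (zRot (1 / (2 * m + 1)))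
    rw [h1, wignerRep_zRot, Matrix.mul_smul, mul_one] at h2
    let i : Fin (2 * m + 1) := ⟨0, by omega⟩
    -- Index `m` is the weight `0`, whose phase is `1`; index `0` is the weight `-m`, which is
    -- different when `m ≠ 0`.
    let j : Fin (2 * m + 1) := ⟨m, by omega⟩
    have h3 := congrFun (congrFun h2 i) i
    rw [Matrix.smul_apply, Matrix.smul_apply, Matrix.diagonal_apply_eq, Matrix.one_apply_eq,
      smul_eq_mul, smul_eq_mul] at h3
    have hne := exp_ne_exp (m := m) (i := i) (j := j) (by
      intro h
      exact h0 (congrArg Fin.val h).symm)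
    have e : Complex.exp (-Complex.I * (((j : ℤ) - m : ℤ) : ℂ) * ((1 / (2 * m + 1) : ℝ) : ℂ)) = 1 := by
      simp [j]
    rw [e] at hne
    have hc0 : c = 0 := by
      by_contra hc0
      exact hne (mul_left_cancel₀ hc0 h3)
    have hm : (2 * m + 1 : ℂ) ≠ 0 := by exact_mod_cast (2 * m).succ_ne_zero
    rw [hc, div_eq_zero_iff, or_iff_left hm] at hc0
    exact_mod_cast hc0

/-- Orthogonality within one row of the matrix entries of `wignerRep m`. -/
theorem integral_star_wignerRep_mul (m : ℕ) (k l j : Fin (2 * m + 1)) :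
    ∫ x, star (wignerRep m x k l) * wignerRep m x k j ∂haarSO3 =
      if l = j then (1 / (2 * m + 1) : ℂ) else 0 := by
  set M : Matrix (Fin (2 * m + 1)) (Fin (2 * m + 1)) ℂ :=
    Matrix.of fun l j => ∫ x, star (wignerRep m x k l) * wignerRep m x k j ∂haarSO3 with hM
  have hint : ∀ l j, Integrable (fun x => star (wignerRep m x k l) * wignerRep m x k j) haarSO3 :=
    fun l j => integrable_of_continuous
      ((continuous_wignerRep_apply m k l).star.mul (continuous_wignerRep_apply m k j))
  -- Right translation of the Gram matrix of row `k` conjugates it by `wignerRep m g`; unitarity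
  -- turns this invariance into commutation.
  have hinv : ∀ g, (wignerRep m g).conjTranspose * M * wignerRep m g = M := by
    intro g
    ext l j
    rw [Matrix.mul_apply]
    simp only [Matrix.mul_apply, Finset.sum_mul, hM, Matrix.of_apply, Matrix.conjTranspose_apply]
    rw [← integral_mul_right_eq_self _ g]
    simp only [wignerRep_mul, Matrix.mul_apply, star_sum, Finset.sum_mul_sum]
    rw [Finset.sum_comm, integral_finsetSum _ fun a _ => ?_]
    · refine Finset.sum_congr rfl fun a _ => ?_
      rw [integral_finsetSum _ fun b _ => ?_]
      · refine Finset.sum_congr rfl fun b _ => ?_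
        rw [← integral_const_mul, ← integral_mul_const]
        congr 1
        ext x
        rw [star_mul']
        ring
      · exact integrable_of_continuous (((continuous_wignerRep_apply m k a).mul
          continuous_const).star.mul ((continuous_wignerRep_apply m k b).mul continuous_const))
    · exact integrable_finsetSum _ fun b _ => integrable_of_continuous
        (((continuous_wignerRep_apply m k a).mul continuous_const).star.mul
          ((continuous_wignerRep_apply m k b).mul continuous_const))
  obtain ⟨c, h⟩ := eq_smul_one_of_commute (A := M) fun g => by
    conv_rhs => rw [← hinv g]
    rw [← mul_assoc, ← mul_assoc, wignerRep_mul_conjTranspose, one_mul]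
  have hm : (2 * m + 1 : ℂ) ≠ 0 := by exact_mod_cast (2 * m).succ_ne_zero
  have htr := congrArg Matrix.trace h
  have htr' : M.trace = 1 := by
    simp only [Matrix.trace, Matrix.diag, hM, Matrix.of_apply]
    rw [← integral_finsetSum _ fun l _ => hint l l]
    have : ∀ x, ∑ l, star (wignerRep m x k l) * wignerRep m x k l = 1 := fun x => by
      have := congrFun (congrFun (wignerRep_mul_conjTranspose m x) k) k
      rw [Matrix.mul_apply, Matrix.one_apply_eq] at this
      rw [← this]
      exact Finset.sum_congr rfl fun l _ => mul_comm _ _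
    simp only [this, integral_const, probReal_univ, one_smul]
  rw [smul_one_trace, htr'] at htr
  have hc : c = 1 / (2 * m + 1) := by
    rw [eq_div_iff hm, ← htr]
  have := congrFun (congrFun h l) j
  rw [Matrix.smul_apply, Matrix.one_apply, hc] at this
  rw [hM, Matrix.of_apply] at this
  rw [this]
  simp

/-- The matrix coefficients of a central convolution kernel. -/
theorem integral_central_kernel (m : ℕ) {f : SO3 → ℂ} (hf : Integrable f haarSO3)
    (hc : ∀ x y, f (x * y) = f (y * x)) (k l : Fin (2 * m + 1)) :
    Integrable (fun z : SO3 × SO3 => f (z.1⁻¹ * z.2) * star (wignerRep m z.1 k l) *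
        wignerRep m z.2 k l) (haarSO3.prod haarSO3) ∧
      ∫ z : SO3 × SO3, f (z.1⁻¹ * z.2) * star (wignerRep m z.1 k l) * wignerRep m z.2 k l
          ∂(haarSO3.prod haarSO3) =
        (∫ x, f x * (((charPoly m).eval (sinSqHalf x) : ℝ) : ℂ) ∂haarSO3) / (2 * m + 1) ^ 2 := by
  -- The measure-preserving change `(x, y) ↦ (x, x⁻¹y)` together with `wignerRep m y = wignerRep m x
  -- * wignerRep m (x⁻¹y)` separates the variables.
  let G : SO3 × SO3 → ℂ := fun z =>
    ∑ j, (star (wignerRep m z.1 k l) * wignerRep m z.1 k j) * (f z.2 * wignerRep m z.2 j l)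
  have hψ := measurePreserving_prod_inv_mul haarSO3 haarSO3
  have hG : ∀ j, Integrable (fun z : SO3 × SO3 =>
      (star (wignerRep m z.1 k l) * wignerRep m z.1 k j) * (f z.2 * wignerRep m z.2 j l))
      (haarSO3.prod haarSO3) := fun j =>
    Integrable.mul_prod (integrable_of_continuous
      ((continuous_wignerRep_apply m k l).star.mul (continuous_wignerRep_apply m k j)))
      (Integrable.mul_continuous hf (continuous_wignerRep_apply m j l))
  have hGi : Integrable G (haarSO3.prod haarSO3) := integrable_finsetSum _ fun j _ => hG j
  have hcomp : (fun z : SO3 × SO3 => f (z.1⁻¹ * z.2) * star (wignerRep m z.1 k l) *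
        wignerRep m z.2 k l) = G ∘ fun z => (z.1, z.1⁻¹ * z.2) := by
    ext z
    have h2 : wignerRep m z.2 k l = ∑ j, wignerRep m z.1 k j * wignerRep m (z.1⁻¹ * z.2) j l := by
      rw [← Matrix.mul_apply, ← wignerRep_mul, mul_inv_cancel_left]
    simp only [G, Function.comp]
    rw [h2, Finset.mul_sum]
    exact Finset.sum_congr rfl fun j _ => by ring
  rw [hcomp]
  refine ⟨hψ.integrable_comp_of_integrable hGi, ?_⟩
  have h1 : ∫ z, (G ∘ fun z => (z.1, z.1⁻¹ * z.2)) z ∂(haarSO3.prod haarSO3) =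
      ∫ z, G z ∂(haarSO3.prod haarSO3) := by
    conv_rhs => rw [← hψ.map_eq]
    rw [integral_map hψ.measurable.aemeasurable (by rw [hψ.map_eq]; exact hGi.1)]
    rfl
  rw [h1, integral_finsetSum _ fun j _ => hG j]
  have h2 : ∀ j, ∫ x, f x * wignerRep m x j l ∂haarSO3 = wignerIntegral m f j l := fun _ => rfl
  have h3 : ∀ j, ∫ z : SO3 × SO3, (star (wignerRep m z.1 k l) * wignerRep m z.1 k j) *
      (f z.2 * wignerRep m z.2 j l) ∂(haarSO3.prod haarSO3) =
        (if l = j then (1 / (2 * m + 1) : ℂ) else 0) * wignerIntegral m f j l := fun j => by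
    rw [integral_prod_mul (fun x => star (wignerRep m x k l) * wignerRep m x k j)
      (fun x => f x * wignerRep m x j l), integral_star_wignerRep_mul, h2]
  -- Only `j = l` survives. Row orthogonality and the scalar transform each contribute a factor `1 /
  -- (2m + 1)`.
  simp_rw [h3, wignerIntegral_central m hf hc]
  simp only [ite_mul, zero_mul, Finset.sum_ite_eq, Finset.mem_univ, if_true, Matrix.smul_apply,
    Matrix.one_apply_eq, smul_eq_mul, mul_one]
  rw [one_div, inv_mul_eq_div, div_div, sq]

/-! ### Moments of the Beta distribution -/

open ProbabilityTheory in
theorem integrable_betaPDFReal {α β : ℝ} (hα : 0 < α) (hβ : 0 < β) :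
    Integrable (betaPDFReal α β) ∧ ∫ x, betaPDFReal α β x = 1 := by
  have h0 : ∀ x, 0 ≤ betaPDFReal α β x := fun x => by
    by_cases h : 0 < x ∧ x < 1
    · exact (betaPDFReal_pos h.1 h.2 hα hβ).le
    · rw [betaPDFReal, if_neg h]
  have h1 : ∫⁻ x, ENNReal.ofReal (betaPDFReal α β x) = 1 := lintegral_betaPDF_eq_one hα hβ
  refine ⟨⟨(measurable_betaPDFReal α β).aestronglyMeasurable, ?_⟩, ?_⟩
  · rw [hasFiniteIntegral_iff_ofReal (ae_of_all _ h0), h1]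
    exact ENNReal.one_lt_top
  · rw [integral_eq_lintegral_of_nonneg_ae (ae_of_all _ h0)
      (measurable_betaPDFReal α β).aestronglyMeasurable, h1, ENNReal.toReal_one]

open ProbabilityTheory in
theorem ae_betaMeasure_mem (α β : ℝ) : ∀ᵐ x ∂betaMeasure α β, x ∈ Set.Ioo (0 : ℝ) 1 := by
  have hm : Measurable (betaPDF α β) := (measurable_betaPDFReal α β).ennreal_ofReal
  rw [betaMeasure, ae_withDensity_iff hm]
  refine ae_of_all _ fun x hx => ?_
  by_contra h
  exact hx (by rw [betaPDF_eq, if_neg (show ¬(0 < x ∧ x < 1) from h), ENNReal.ofReal_zero])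

-- Multiplying the Beta(`α`, `β`) density by `x^q` gives a multiple of the Beta(`α + q`, `β`)
-- density.
open ProbabilityTheory in
theorem integral_rpow_betaMeasure {α β q : ℝ} (hα : 0 < α) (hβ : 0 < β) (hq : 0 < α + q) :
    Integrable (fun x => x ^ q) (betaMeasure α β) ∧
      ∫ x, x ^ q ∂betaMeasure α β = beta (α + q) β / beta α β := by
  have hm : Measurable (betaPDF α β) := (measurable_betaPDFReal α β).ennreal_ofReal
  have hfin : ∀ᵐ x : ℝ, betaPDF α β x < ⊤ := ae_of_all _ fun x => ENNReal.ofReal_lt_top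
  have key : (fun x : ℝ => (betaPDF α β x).toReal • x ^ q) =
      fun x => beta (α + q) β / beta α β * betaPDFReal (α + q) β x := by
    ext x
    by_cases h : 0 < x ∧ x < 1
    · have hp := betaPDFReal_pos h.1 h.2 hα hβ
      rw [betaPDF, ENNReal.toReal_ofReal hp.le, betaPDFReal, betaPDFReal, if_pos h, if_pos h,
        smul_eq_mul, show α + q - 1 = α - 1 + q by ring, Real.rpow_add h.1]
      have h1 := (beta_pos hα hβ).ne'
      have h2 := (beta_pos hq hβ).ne'
      field_simp
    · rw [betaPDF, betaPDFReal, betaPDFReal, if_neg h, if_neg h]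
      simp
  obtain ⟨h1, h2⟩ := integrable_betaPDFReal hq hβ
  constructor
  · rw [betaMeasure, integrable_withDensity_iff_integrable_smul' hm hfin, key]
    exact h1.const_mul _
  · rw [betaMeasure, integral_withDensity_eq_integral_toReal_smul hm hfin, key,
      integral_const_mul, h2, mul_one]

/-- The values of `∫ sin^(2q) (ω / 2) χ_m`, where `χ_m` are the characters of `SO(3)`. -/
noncomputable def charMoment (m : ℕ) (q : ℝ) : ℝ :=
  2 * Real.Gamma (q + 3 / 2) / √Real.pi * ((ascPochhammer ℝ m).eval (-q) / Real.Gamma (q + 2 + m))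

theorem ascPochhammer_eval_succ_left (m : ℕ) (t : ℝ) :
    (ascPochhammer ℝ (m + 1)).eval t = t * (ascPochhammer ℝ m).eval (t + 1) := by
  simp [ascPochhammer_succ_left]

theorem charMoment_one {q : ℝ} (hq : -(3 / 2) < q) :
    charMoment 1 q = 3 * charMoment 0 q - 4 * charMoment 0 (q + 1) := by
  have g1 : Real.Gamma (q + 1 + 3 / 2) = (q + 3 / 2) * Real.Gamma (q + 3 / 2) := by
    rw [← Real.Gamma_add_one (by linarith)]
    ring_nf
  have g2 : Real.Gamma (q + 1 + 2) = (q + 2) * Real.Gamma (q + 2) := by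
    rw [← Real.Gamma_add_one (by linarith)]
    ring_nf
  have g3 : Real.Gamma (q + 2 + 1) = (q + 2) * Real.Gamma (q + 2) :=
    Real.Gamma_add_one (by linarith)
  have h1 : Real.Gamma (q + 2) ≠ 0 := (Real.Gamma_pos_of_pos (by linarith)).ne'
  have h2 : q + 2 ≠ 0 := by linarith
  have h3 : √Real.pi ≠ 0 := (Real.sqrt_pos.2 Real.pi_pos).ne'
  simp only [charMoment, ascPochhammer_zero, ascPochhammer_one, Polynomial.eval_one,
    Polynomial.eval_X, Nat.cast_zero, Nat.cast_one, add_zero, g1, g2, g3]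
  field_simp
  ring

/-- The recurrence of `charPoly` multiplied by `x^q` and integrated. The functional equation of `Γ`
and the two ends of the Pochhammer product reduce it to a rational identity. -/
theorem charMoment_add_two (m : ℕ) {q : ℝ} (hq : -(3 / 2) < q) :
    charMoment (m + 2) q =
      2 * charMoment (m + 1) q - 4 * charMoment (m + 1) (q + 1) - charMoment m q := by
  have hm : (0 : ℝ) ≤ m := Nat.cast_nonneg m
  have g0 : Real.Gamma (q + 1 + 3 / 2) = (q + 3 / 2) * Real.Gamma (q + 3 / 2) := by
    rw [← Real.Gamma_add_one (by linarith)]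
    ring_nf
  have g1 : Real.Gamma (q + 2 + (m + 1 : ℕ)) = (q + 2 + m) * Real.Gamma (q + 2 + m) := by
    rw [← Real.Gamma_add_one (by linarith)]
    push_cast
    ring_nf
  have g2 : Real.Gamma (q + 2 + (m + 2 : ℕ)) =
      (q + 2 + m + 1) * ((q + 2 + m) * Real.Gamma (q + 2 + m)) := by
    rw [← Real.Gamma_add_one (by linarith), ← Real.Gamma_add_one (by linarith)]
    push_cast
    ring_nf
  have g3 : Real.Gamma (q + 1 + 2 + (m + 1 : ℕ)) =
      (q + 2 + m + 1) * ((q + 2 + m) * Real.Gamma (q + 2 + m)) := by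
    rw [← g2]
    push_cast
    ring_nf
  have p1 : (ascPochhammer ℝ (m + 1)).eval (-(q + 1)) =
      -(q + 1) * (ascPochhammer ℝ m).eval (-q) := by
    rw [ascPochhammer_eval_succ_left]
    ring_nf
  have h1 : Real.Gamma (q + 2 + m) ≠ 0 := (Real.Gamma_pos_of_pos (by linarith)).ne'
  have h2 : q + 2 + m ≠ 0 := by linarith
  have h2' : q + 2 + m + 1 ≠ 0 := by linarith
  have h3 : √Real.pi ≠ 0 := (Real.sqrt_pos.2 Real.pi_pos).ne'
  simp only [charMoment, g0, g1, g2, g3, p1, ascPochhammer_succ_eval]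
  push_cast
  field_simp
  ring

theorem charPoly_eval_add_two (m : ℕ) (x : ℝ) : (charPoly (m + 2)).eval x =
    (2 - 4 * x) * (charPoly (m + 1)).eval x - (charPoly m).eval x := by
  simp [charPoly]

theorem charPoly_eval_one (x : ℝ) : (charPoly 1).eval x = 3 - 4 * x := by
  simp [charPoly]

theorem charPoly_eval_zero (x : ℝ) : (charPoly 0).eval x = 1 := by
  simp [charPoly]

open ProbabilityTheory in
theorem integral_rpow_mul_charPoly (m : ℕ) {q : ℝ} (hq : -(3 / 2) < q) :
    Integrable (fun x => x ^ q * (charPoly m).eval x) (betaMeasure (3 / 2) (1 / 2)) ∧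
      ∫ x, x ^ q * (charPoly m).eval x ∂betaMeasure (3 / 2) (1 / 2) = charMoment m q := by
  have hzero : ∀ q : ℝ, -(3 / 2) < q →
      Integrable (fun x : ℝ => x ^ q) (betaMeasure (3 / 2) (1 / 2)) ∧
      ∫ x, x ^ q ∂betaMeasure (3 / 2) (1 / 2) = charMoment 0 q := by
    intro q hq
    obtain ⟨h1, h2⟩ := integral_rpow_betaMeasure (α := 3 / 2) (β := 1 / 2) (q := q)
      (by norm_num) (by norm_num) (by linarith)
    refine ⟨h1, h2.trans ?_⟩
    have g1 : Real.Gamma (3 / 2) = 1 / 2 * √Real.pi := by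
      rw [← Real.Gamma_one_half_eq, ← Real.Gamma_add_one (by norm_num)]
      norm_num
    have h3 : √Real.pi ≠ 0 := (Real.sqrt_pos.2 Real.pi_pos).ne'
    have g2 : Real.Gamma (3 / 2 + 1 / 2) = 1 := by
      rw [show (3 / 2 + 1 / 2 : ℝ) = 2 by norm_num, Real.Gamma_two]
    have h4 : Real.Gamma (q + 2) ≠ 0 := (Real.Gamma_pos_of_pos (by linarith)).ne'
    rw [beta, beta, g1, g2, Real.Gamma_one_half_eq, charMoment,
      show 3 / 2 + q + 1 / 2 = q + 2 by ring, show 3 / 2 + q = q + 3 / 2 by ring]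
    simp only [ascPochhammer_zero, Polynomial.eval_one, Nat.cast_zero, add_zero]
    field_simp
  have hae := ae_betaMeasure_mem (3 / 2) (1 / 2)
  have hadd : ∀ q : ℝ, ∀ x ∈ Set.Ioo (0 : ℝ) 1, x ^ (q + 1) = x ^ q * x := fun q x hx => by
    rw [Real.rpow_add hx.1, Real.rpow_one]
  induction m using Nat.twoStepInduction generalizing q with
  | zero => simpa [charPoly_eval_zero] using hzero q hq
  | one =>
    obtain ⟨i1, e1⟩ := hzero q hq
    obtain ⟨i2, e2⟩ := hzero (q + 1) (by linarith)
    have heq : (fun x : ℝ => 3 * x ^ q - 4 * x ^ (q + 1)) =ᵐ[betaMeasure (3 / 2) (1 / 2)]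
        fun x => x ^ q * (charPoly 1).eval x := by
      filter_upwards [hae] with x hx
      rw [hadd q x hx, charPoly_eval_one]
      ring
    refine ⟨((i1.const_mul 3).sub (i2.const_mul 4)).congr heq, ?_⟩
    rw [← integral_congr_ae heq, integral_sub (i1.const_mul 3) (i2.const_mul 4),
      integral_const_mul, integral_const_mul, e1, e2, charMoment_one hq]
  | more m ih1 ih2 =>
    obtain ⟨i1, e1⟩ := ih1 hq
    obtain ⟨i2, e2⟩ := ih2 hq
    obtain ⟨i3, e3⟩ := ih2 (q := q + 1) (by linarith)
    have heq : (fun x : ℝ => 2 * (x ^ q * (charPoly (m + 1)).eval x) -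
        4 * (x ^ (q + 1) * (charPoly (m + 1)).eval x) - x ^ q * (charPoly m).eval x)
        =ᵐ[betaMeasure (3 / 2) (1 / 2)] fun x => x ^ q * (charPoly (m + 2)).eval x := by
      filter_upwards [hae] with x hx
      rw [hadd q x hx, charPoly_eval_add_two]
      ring
    refine ⟨(((i2.const_mul 2).sub (i3.const_mul 4)).sub i1).congr heq, ?_⟩
    have i4 : Integrable (fun x : ℝ => 2 * (x ^ q * (charPoly (m + 1)).eval x) -
        4 * (x ^ (q + 1) * (charPoly (m + 1)).eval x)) (betaMeasure (3 / 2) (1 / 2)) :=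
      (i2.const_mul 2).sub (i3.const_mul 4)
    rw [← integral_congr_ae heq, integral_sub i4 i1, integral_sub (i2.const_mul 2) (i3.const_mul 4),
      integral_const_mul, integral_const_mul, e1, e2, e3, charMoment_add_two m hq]

theorem charMoment_zero_right (m : ℕ) : charMoment m 0 = if m = 0 then 1 else 0 := by
  cases m with
  | zero =>
    have g1 : Real.Gamma (3 / 2) = 1 / 2 * √Real.pi := by
      rw [← Real.Gamma_one_half_eq, ← Real.Gamma_add_one (by norm_num)]
      norm_num
    have h3 : √Real.pi ≠ 0 := (Real.sqrt_pos.2 Real.pi_pos).ne'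
    simp [charMoment, g1, h3]
  | succ m => simp [charMoment]

/-! ### The law of `sin² (ω / 2)` under Haar measure -/

/-- Solved for `X * charPoly m`, the recurrence shows that the span is closed under multiplication
by `X`; it contains `1`. -/
theorem mem_span_charPoly (P : Polynomial ℝ) : P ∈ Submodule.span ℝ (Set.range charPoly) := by
  have hmem : ∀ m, charPoly m ∈ Submodule.span ℝ (Set.range charPoly) := fun m =>
    Submodule.subset_span ⟨m, rfl⟩
  have hX : ∀ Q ∈ Submodule.span ℝ (Set.range charPoly),
      Polynomial.X * Q ∈ Submodule.span ℝ (Set.range charPoly) := by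
    intro Q hQ
    induction hQ using Submodule.span_induction with
    | mem Q hQ =>
      obtain ⟨m, rfl⟩ := hQ
      cases m with
      | zero =>
        have : Polynomial.X * charPoly 0 = (1 / 4 : ℝ) • ((3 : ℝ) • charPoly 0 - charPoly 1) := by
          refine Polynomial.funext fun x => ?_
          simp only [Polynomial.eval_mul, Polynomial.eval_X, Polynomial.eval_smul,
            Polynomial.eval_sub, charPoly_eval_zero, charPoly_eval_one, smul_eq_mul]
          ring
        rw [this]
        exact Submodule.smul_mem _ _ (Submodule.sub_mem _ (Submodule.smul_mem _ _ (hmem 0)) (hmem 1))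
      | succ m =>
        have : Polynomial.X * charPoly (m + 1) =
            (1 / 4 : ℝ) • ((2 : ℝ) • charPoly (m + 1) - charPoly (m + 2) - charPoly m) := by
          refine Polynomial.funext fun x => ?_
          simp only [Polynomial.eval_mul, Polynomial.eval_X, Polynomial.eval_smul,
            Polynomial.eval_sub, charPoly_eval_add_two, smul_eq_mul]
          ring
        rw [this]
        exact Submodule.smul_mem _ _ (Submodule.sub_mem _ (Submodule.sub_mem _
          (Submodule.smul_mem _ _ (hmem _)) (hmem _)) (hmem _))
    | zero => simp
    | add Q R _ _ hQ hR =>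
      rw [mul_add]
      exact Submodule.add_mem _ hQ hR
    | smul c Q _ hQ =>
      rw [mul_smul_comm]
      exact Submodule.smul_mem _ _ hQ
  have hpow : ∀ n, (Polynomial.X : Polynomial ℝ) ^ n ∈
      Submodule.span ℝ (Set.range charPoly) := by
    intro n
    induction n with
    | zero =>
      have := hmem 0
      rwa [charPoly] at this
    | succ n ih =>
      rw [pow_succ']
      exact hX _ ih
  induction P using Polynomial.induction_on' with
  | add P Q hP hQ => exact Submodule.add_mem _ hP hQ
  | monomial n a =>
    rw [← Polynomial.C_mul_X_pow_eq_monomial, ← Polynomial.smul_eq_C_mul]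
    exact Submodule.smul_mem _ _ (hpow n)

theorem integrable_eval_of_ae_mem {μ : Measure ℝ} [IsProbabilityMeasure μ]
    (hμ : ∀ᵐ x ∂μ, x ∈ Set.Icc (0 : ℝ) 1) (P : Polynomial ℝ) :
    Integrable (fun x => P.eval x) μ := by
  obtain ⟨C, hC⟩ := isCompact_Icc.exists_bound_of_continuousOn
    (P.continuous.continuousOn (s := Set.Icc (0 : ℝ) 1))
  exact Integrable.of_bound P.continuous.aestronglyMeasurable C (hμ.mono fun x hx => hC x hx)

/-- A probability measure on `[0, 1]` is determined by its integrals against `charPoly`. -/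
theorem measure_ext_of_charPoly {μ ν : Measure ℝ} [IsProbabilityMeasure μ] [IsProbabilityMeasure ν]
    (hμ : ∀ᵐ x ∂μ, x ∈ Set.Icc (0 : ℝ) 1) (hν : ∀ᵐ x ∂ν, x ∈ Set.Icc (0 : ℝ) 1)
    (h : ∀ m, ∫ x, (charPoly m).eval x ∂μ = ∫ x, (charPoly m).eval x ∂ν) : μ = ν := by
  have hpoly : ∀ P : Polynomial ℝ, ∫ x, P.eval x ∂μ = ∫ x, P.eval x ∂ν := by
    intro P
    induction mem_span_charPoly P using Submodule.span_induction with
    | mem Q hQ =>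
      obtain ⟨m, rfl⟩ := hQ
      exact h m
    | zero => simp
    | add Q R _ _ hQ hR =>
      simp only [Polynomial.eval_add]
      rw [integral_add (integrable_eval_of_ae_mem hμ _) (integrable_eval_of_ae_mem hμ _),
        integral_add (integrable_eval_of_ae_mem hν _) (integrable_eval_of_ae_mem hν _), hQ, hR]
    | smul c Q _ hQ =>
      simp only [Polynomial.eval_smul, smul_eq_mul, integral_const_mul, hQ]
  refine ext_of_forall_integral_eq_of_IsFiniteMeasure fun f => ?_
  have hbound : ∀ (ρ : Measure ℝ) [IsProbabilityMeasure ρ], (∀ᵐ x ∂ρ, x ∈ Set.Icc (0 : ℝ) 1) →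
      ∀ (P : Polynomial ℝ) (ε : ℝ), (∀ x ∈ Set.Icc (0 : ℝ) 1, |P.eval x - f x| < ε) →
      |∫ x, P.eval x ∂ρ - ∫ x, f x ∂ρ| ≤ ε := by
    intro ρ _ hρ P ε hP
    rw [← integral_sub (integrable_eval_of_ae_mem hρ _) (f.integrable ρ)]
    have := norm_integral_le_of_norm_le_const (μ := ρ) (f := fun x => P.eval x - f x) (C := ε)
      (hρ.mono fun x hx => (hP x hx).le)
    simpa using this
  refine eq_of_forall_dist_le fun ε hε => ?_
  -- Weierstrass approximation on `[0, 1]`, which carries both measures; `ε / 2` is spent once for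
  -- each.
  obtain ⟨P, hP⟩ := exists_polynomial_near_of_continuousOn 0 1 f f.continuous.continuousOn (ε / 2)
    (by positivity)
  have h1 := hbound μ hμ P _ hP
  have h2 := hbound ν hν P _ hP
  rw [hpoly P] at h1
  rw [Real.dist_eq]
  rw [abs_le] at h1 h2 ⊢
  constructor <;> linarith [h1.1, h1.2, h2.1, h2.2]

open ProbabilityTheory in
/-- The distribution of `sin² (ω / 2)` for a random rotation by the angle `ω`. -/
theorem map_sinSqHalf : Measure.map sinSqHalf haarSO3 = betaMeasure (3 / 2) (1 / 2) := by
  have hm := continuous_sinSqHalf.measurable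
  have := Measure.isProbabilityMeasure_map (μ := haarSO3) hm.aemeasurable
  have := isProbabilityMeasureBeta (α := 3 / 2) (β := 1 / 2) (by norm_num) (by norm_num)
  refine measure_ext_of_charPoly ?_ ?_ fun m => ?_
  · exact (ae_map_iff hm.aemeasurable measurableSet_Icc).2 (ae_of_all _ sinSqHalf_mem)
  · exact (ae_betaMeasure_mem _ _).mono fun x hx => Set.Ioo_subset_Icc_self hx
  -- On the Haar side the value is that of `integral_charPoly`; on the Beta side it is `charMoment m
  -- 0`, and both are `1` for `m = 0` and `0` otherwise.
  · rw [integral_map hm.aemeasurable (charPoly m).continuous.aestronglyMeasurable,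
      integral_charPoly, ← charMoment_zero_right,
      ← (integral_rpow_mul_charPoly m (q := 0) (by norm_num)).2]
    simp

theorem integrable_sinSqHalf_rpow {q : ℝ} (hq : -(3 / 2) < q) :
    Integrable (fun x => sinSqHalf x ^ q) haarSO3 := by
  have hm := continuous_sinSqHalf.measurable
  have h := (integral_rpow_mul_charPoly 0 hq).1
  rw [← map_sinSqHalf] at h
  have h' := h.comp_measurable hm
  simpa [Function.comp_def, charPoly_eval_zero] using h'

theorem integral_sinSqHalf_rpow_mul_charPoly (m : ℕ) {q : ℝ} (hq : -(3 / 2) < q) :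
    ∫ x, sinSqHalf x ^ q * (charPoly m).eval (sinSqHalf x) ∂haarSO3 = charMoment m q := by
  have hm := continuous_sinSqHalf.measurable
  rw [← (integral_rpow_mul_charPoly m hq).2, ← map_sinSqHalf, integral_map hm.aemeasurable]
  exact Measurable.aestronglyMeasurable
    ((measurable_id.pow_const q).mul (charPoly m).continuous.measurable)

/-! ### Finite expansion of integer powers in characters -/

theorem charMoment_eq_zero {m n : ℕ} (h : n < m) : charMoment m n = 0 := by
  rw [charMoment, ascPochhammer_eval_neg_coe_nat_of_lt h]
  simp

theorem pow_eq_sum_charMoment (n : ℕ) (x : ℝ) {N : ℕ} (hN : n < N) :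
    x ^ n = ∑ m ∈ Finset.range N, charMoment m n * (charPoly m).eval x := by
  -- Summation by parts: `charPoly` and `charMoment` satisfy the same three-term recurrence, so
  -- multiplication by `x` moves from the former to the shift `n ↦ n + 1` in the latter, at the cost
  -- of boundary terms.
  have green : ∀ (n N : ℕ), 4 * x * ∑ m ∈ Finset.range (N + 1),
      charMoment m n * (charPoly m).eval x =
      4 * ∑ m ∈ Finset.range (N + 1), charMoment m (n + 1 : ℕ) * (charPoly m).eval x +
        charMoment (N + 1) n * (charPoly N).eval x - charMoment N n * (charPoly (N + 1)).eval x := by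
    intro n N
    have hn : -(3 / 2) < (n : ℝ) := by
      have : (0 : ℝ) ≤ n := Nat.cast_nonneg n
      linarith
    induction N with
    | zero =>
      have := charMoment_one hn
      simp only [zero_add, Finset.sum_range_one, charPoly_eval_zero, charPoly_eval_one]
      push_cast
      linear_combination -this
    | succ N ih =>
      have := charMoment_add_two N hn
      rw [Finset.sum_range_succ, mul_add, ih, Finset.sum_range_succ _ (N + 1),
        charPoly_eval_add_two]
      push_cast at this ⊢
      linear_combination -(charPoly (N + 1)).eval x * this
  induction n generalizing N with
  | zero =>
    rw [Finset.sum_eq_single 0]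
    · simp [charMoment_zero_right, charPoly_eval_zero]
    · intro m _ hm
      simp [charMoment_zero_right, hm]
    · intro h
      simp at h
      omega
  | succ n ih =>
    obtain ⟨M, rfl⟩ : ∃ M, N = M + 1 := ⟨N - 1, by omega⟩
    have h := green n M
    -- The boundary terms vanish because both `M` and `M + 1` exceed `n`.
    rw [charMoment_eq_zero (by omega : n < M + 1), charMoment_eq_zero (by omega : n < M),
      ← ih (by omega)] at h
    rw [pow_succ]
    linarith

/-! ### The kernel and its coefficients -/

/-- Orthogonality gives `‖x - y‖_F² = 8 sin² (ω / 2)` with `ω` the angle of `x⁻¹y`, and `2^{-p/2}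
8^{p/2} = 2^p`. -/
theorem kernel_eq (p : ℝ) (x y : SO3) :
    kernel p x y = (2 : ℝ) ^ p * sinSqHalf (x⁻¹ * y) ^ (p / 2) := by
  have h0 := (sinSqHalf_mem (x⁻¹ * y)).1
  have htr : ((x.1 - y.1).transpose * (x.1 - y.1)).trace = 8 * sinSqHalf (x⁻¹ * y) := by
    have h1 : (x⁻¹ * y).1 = x.1.transpose * y.1 := rfl
    have h2 : (y.1.transpose * x.1).trace = (x.1.transpose * y.1).trace := by
      rw [← Matrix.trace_transpose, Matrix.transpose_mul, Matrix.transpose_transpose]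
    rw [sinSqHalf, h1, Matrix.transpose_sub, sub_mul, mul_sub, mul_sub, transpose_mul_self,
      transpose_mul_self, Matrix.trace_sub, Matrix.trace_sub, Matrix.trace_sub, h2,
      Matrix.trace_one]
    simp
    ring
  have h8 : (8 : ℝ) ^ (p / 2) = (2 : ℝ) ^ (3 * (p / 2)) := by
    rw [Real.rpow_mul (by norm_num)]
    norm_num
  rw [kernel, frobeniusNorm, htr, Real.sqrt_eq_rpow, ← Real.rpow_mul (by positivity),
    show 1 / 2 * p = p / 2 by ring, Real.mul_rpow (by norm_num) h0, ← mul_assoc, h8,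
    ← Real.rpow_add (by norm_num)]
  congr 2
  ring

theorem exists_fin_sub_eq {m : ℕ} {k : ℤ} (hk : |k| ≤ m) :
    ∃ i : Fin (2 * m + 1), (i : ℤ) - m = k := by
  rw [abs_le] at hk
  exact ⟨⟨(k + m).toNat, by omega⟩, by simp; omega⟩

theorem sum_Icc_eq_sum_fin (m : ℕ) (g : ℤ → ℂ) :
    ∑ k ∈ Finset.Icc (-(m : ℤ)) m, g k = ∑ i : Fin (2 * m + 1), g ((i : ℤ) - m) := by
  symm
  refine Finset.sum_bij (fun i _ => (i : ℤ) - m) ?_ ?_ ?_ fun _ _ => rfl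
  · intro i _
    have := i.2
    rw [Finset.mem_Icc]
    omega
  · intro i _ j _ h
    ext
    omega
  · intro k hk
    obtain ⟨i, hi⟩ := exists_fin_sub_eq (m := m) (k := k) (abs_le.2 (Finset.mem_Icc.1 hk))
    exact ⟨i, Finset.mem_univ _, hi⟩

theorem sqrt_mul_sqrt_eq (m : ℕ) :
    ((√(2 * m + 1) : ℝ) : ℂ) * ((√(2 * m + 1) : ℝ) : ℂ) = 2 * m + 1 := by
  rw [← Complex.ofReal_mul, Real.mul_self_sqrt (by positivity)]
  push_cast
  rfl

theorem sinSqHalf_inv (x : SO3) : sinSqHalf x⁻¹ = sinSqHalf x := by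
  unfold sinSqHalf
  rw [show (x⁻¹).1 = x.1.transpose from rfl, Matrix.trace_transpose]

/-- The addition theorem for the Wigner functions. -/
theorem sum_wignerD_mul_conj (m : ℕ) (x y : SO3) :
    ∑ k ∈ Finset.Icc (-(m : ℤ)) m, ∑ l ∈ Finset.Icc (-(m : ℤ)) m,
        wignerD m k l x * (starRingEnd ℂ) (wignerD m k l y) =
      (2 * m + 1) * (((charPoly m).eval (sinSqHalf (x⁻¹ * y)) : ℝ) : ℂ) := by
  have hS : sinSqHalf (x⁻¹ * y) = sinSqHalf (x * y⁻¹) := by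
    rw [sinSqHalf_mul_comm, ← sinSqHalf_inv]
    group
  rw [hS, ← trace_wignerRep, wignerRep_mul, wignerRep_inv]
  simp_rw [sum_Icc_eq_sum_fin, wignerD_eq_wignerRep, map_mul, Complex.conj_ofReal]
  rw [Matrix.trace, Finset.mul_sum]
  refine Finset.sum_congr rfl fun i _ => ?_
  rw [Matrix.diag_apply, Matrix.mul_apply, Finset.mul_sum]
  refine Finset.sum_congr rfl fun j _ => ?_
  rw [Matrix.conjTranspose_apply, ← sqrt_mul_sqrt_eq, starRingEnd_apply]
  ring

/-- The Fourier coefficients of the kernel `2^{-p/2} ‖x - y‖_F^p`. -/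
noncomputable def kernelCoeff (p : ℝ) (m : ℕ) : ℝ :=
  (2 : ℝ) ^ p * charMoment m (p / 2) / (2 * m + 1)

/-- The `L²` normalization contributes `2m + 1` against the `(2m + 1)²` of
`integral_central_kernel`. The bound on `p` is exactly positivity of the Beta parameter `3/2 + p/2`.
-/
theorem integrable_coeffIntegrand_and_wignerCoeff {p : ℝ} (hp : -3 < p) (m : ℕ) {k l : ℤ}
    (hk : |k| ≤ m) (hl : |l| ≤ m) :
    Integrable (coeffIntegrand p m k l) (haarSO3.prod haarSO3) ∧
      wignerCoeff p m k l = (kernelCoeff p m : ℂ) := by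
  obtain ⟨i, rfl⟩ := exists_fin_sub_eq hk
  obtain ⟨j, rfl⟩ := exists_fin_sub_eq hl
  have hq : -(3 / 2) < p / 2 := by linarith
  let f : SO3 → ℂ := fun x => (((2 : ℝ) ^ p * sinSqHalf x ^ (p / 2) : ℝ) : ℂ)
  have hf : Integrable f haarSO3 := ((integrable_sinSqHalf_rpow hq).const_mul _).ofReal
  have hc : ∀ x y, f (x * y) = f (y * x) := fun x y => by
    simp only [f, sinSqHalf_mul_comm x y]
  obtain ⟨h1, h2⟩ := integral_central_kernel m hf hc i j
  have heq : coeffIntegrand p m ((i : ℤ) - m) ((j : ℤ) - m) = fun z : SO3 × SO3 =>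
      (2 * m + 1 : ℂ) * (f (z.1⁻¹ * z.2) * star (wignerRep m z.1 i j) * wignerRep m z.2 i j) := by
    ext z
    rw [coeffIntegrand, kernel_eq, wignerD_eq_wignerRep, wignerD_eq_wignerRep, map_mul,
      Complex.conj_ofReal, ← sqrt_mul_sqrt_eq, starRingEnd_apply]
    ring
  refine ⟨heq ▸ h1.const_mul _, ?_⟩
  have hm : (2 * m + 1 : ℂ) ≠ 0 := by exact_mod_cast (2 * m).succ_ne_zero
  rw [wignerCoeff, heq, integral_const_mul, h2]
  have h3 : ∫ x, f x * (((charPoly m).eval (sinSqHalf x) : ℝ) : ℂ) ∂haarSO3 =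
      (((2 : ℝ) ^ p * charMoment m (p / 2) : ℝ) : ℂ) := by
    rw [← integral_sinSqHalf_rpow_mul_charPoly m hq, ← integral_const_mul,
      ← integral_complex_ofReal]
    congr 1
    ext x
    simp only [f]
    push_cast
    ring
  rw [h3, kernelCoeff]
  push_cast
  field_simp

/-! ### Closed form and asymptotics -/

theorem kernelCoeff_eq (p : ℝ) (m : ℕ) :
    kernelCoeff p m = (2 : ℝ) ^ p * Real.Gamma (p / 2 + 3 / 2) / √Real.pi *
      ((ascPochhammer ℝ m).eval (-p / 2) / Real.Gamma (p / 2 + 2 + m)) * (1 / (m + 1 / 2)) := by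
  have hm : (m : ℝ) + 1 / 2 ≠ 0 := by positivity
  have hm' : 2 * (m : ℝ) + 1 ≠ 0 := by positivity
  rw [kernelCoeff, charMoment, neg_div]
  rw [show (m : ℝ) + 1 / 2 = (2 * m + 1) / 2 by ring]
  field_simp

theorem Gamma_add_nat_eq {s : ℝ} (hs : ∀ n : ℕ, s + n ≠ 0) (m : ℕ) :
    Real.Gamma (s + m) = (ascPochhammer ℝ m).eval s * Real.Gamma s := by
  induction m with
  | zero => simp
  | succ m ih =>
    rw [ascPochhammer_succ_eval, mul_right_comm, ← ih, Nat.cast_succ, ← add_assoc,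
      Real.Gamma_add_one (hs m), mul_comm]

/-- The inverted form of Euler's limit `m^s m! / (s (s+1) ⋯ (s+m)) → Γ(s)`. -/
theorem tendsto_Gamma_add_nat {s : ℝ} (hs : ∀ n : ℕ, s + n ≠ 0) :
    Tendsto (fun m : ℕ => (s + m) * Real.Gamma (s + m) / ((m : ℝ) ^ s * m.factorial))
      atTop (𝓝 1) := by
  have hG : Real.Gamma s ≠ 0 := Real.Gamma_ne_zero fun n h => hs n (by rw [h]; ring)
  have hprod : ∀ m : ℕ, (s + m) * Real.Gamma (s + m) =
      (∏ j ∈ Finset.range (m + 1), (s + j)) * Real.Gamma s := by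
    intro m
    have hasc : ∀ m : ℕ, (ascPochhammer ℝ m).eval s = ∏ j ∈ Finset.range m, (s + j) := by
      intro m
      induction m with
      | zero => simp
      | succ m ih => rw [ascPochhammer_succ_eval, ih, Finset.prod_range_succ]
    rw [Gamma_add_nat_eq hs, ← mul_assoc, mul_comm (s + (m : ℝ)), ← ascPochhammer_succ_eval, hasc]
  have h := ((Real.GammaSeq_tendsto_Gamma s).inv₀ hG).const_mul (Real.Gamma s)
  rw [mul_inv_cancel₀ hG] at h
  refine h.congr fun m => ?_
  rw [hprod, Real.GammaSeq, inv_div]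
  ring

theorem kernelCoeff_eq_Gamma {p : ℝ} (hp : ∀ n : ℕ, p ≠ 2 * n) (m : ℕ) :
    kernelCoeff p m =
      (2 : ℝ) ^ p * Real.Gamma (p / 2 + 3 / 2) / (√Real.pi * Real.Gamma (-p / 2)) *
        (Real.Gamma (-p / 2 + m) / Real.Gamma (p / 2 + 2 + m)) * (1 / (m + 1 / 2)) := by
  have hs : ∀ n : ℕ, -p / 2 + n ≠ 0 := fun n h => hp n (by linarith)
  have hG : Real.Gamma (-p / 2) ≠ 0 := Real.Gamma_ne_zero fun n h => hs n (by rw [h]; ring)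
  rw [kernelCoeff_eq, Gamma_add_nat_eq hs]
  generalize Real.Gamma (-p / 2) = G at hG
  field_simp

theorem exists_Gamma_ratio_asymptotics {q : ℝ} (hq : -2 < q) (hs : ∀ n : ℕ, -q + n ≠ 0) :
    ∃ R : ℕ → ℝ, Tendsto R atTop (𝓝 1) ∧ ∀ m : ℕ, 1 ≤ m →
      Real.Gamma (-q + m) / Real.Gamma (q + 2 + m) * (1 / (m + 1 / 2)) =
        (m : ℝ) ^ (-(2 * q + 3)) * R m := by
  have hs' : ∀ n : ℕ, q + 2 + n ≠ 0 := fun n => by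
    have : (0 : ℝ) ≤ n := Nat.cast_nonneg n
    linarith
  have hlin : ∀ a b : ℝ, Tendsto (fun m : ℕ => (a + m) / (b + m)) atTop (𝓝 1) := by
    intro a b
    have h1 : ∀ c : ℝ, Tendsto (fun m : ℕ => c / (m : ℝ) + 1) atTop (𝓝 1) := fun c => by
      simpa using (tendsto_const_div_atTop_nhds_zero_nat c).add_const 1
    have h2 := (h1 a).div (h1 b) one_ne_zero
    rw [div_one] at h2
    refine h2.congr' ?_
    filter_upwards [eventually_gt_atTop 0] with m hm
    have hm' : (m : ℝ) ≠ 0 := by positivity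
    simp only [Pi.div_apply]
    rw [div_add_one hm', div_add_one hm', div_div_div_cancel_right₀ hm']
  -- Dividing the limits for `s = -q` and `s = q + 2` cancels the factorials and leaves the power
  -- `m^(-2q-2)`. The two rational factors remove the stray linear terms and turn `1 / (m + 1/2)`
  -- into the last `1 / m`.
  have hlim := (((tendsto_Gamma_add_nat hs).div (tendsto_Gamma_add_nat hs') one_ne_zero).mul
    (hlin (q + 2) (-q))).mul (hlin 0 (1 / 2))
  simp only [div_one, mul_one] at hlim
  refine ⟨_, hlim, fun m hm => ?_⟩
  have hm0 : (0 : ℝ) < m := by exact_mod_cast hm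
  have h1 := hs m
  have h2 := hs' m
  have h3 : Real.Gamma (q + 2 + m) ≠ 0 := (Real.Gamma_pos_of_pos (by linarith)).ne'
  have h4 : (m.factorial : ℝ) ≠ 0 := Nat.cast_ne_zero.2 m.factorial_ne_zero
  have h5 : (m : ℝ) ^ (q + 2) = (m : ℝ) ^ q * (m : ℝ) ^ 2 := by
    rw [Real.rpow_add hm0, Real.rpow_two]
  have h6 : (m : ℝ) ^ (-(2 * q + 3)) = ((m : ℝ) ^ q * (m : ℝ) ^ q * (m : ℝ) ^ 3)⁻¹ := by
    rw [Real.rpow_neg hm0.le, two_mul, Real.rpow_add hm0, Real.rpow_add hm0]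
    norm_cast
  have h7 : (m : ℝ) ^ q ≠ 0 := (Real.rpow_pos_of_pos hm0 q).ne'
  have h8 : (1 / 2 + m : ℝ) ≠ 0 := by positivity
  simp only [Pi.div_apply]
  rw [h5, h6, Real.rpow_neg hm0.le, zero_add, add_comm (m : ℝ) (1 / 2)]
  field_simp

theorem kernelCoeff_asymptotics {p : ℝ} (hp : -3 < p) (hpn : ∀ n : ℕ, p ≠ 2 * n) :
    ∃ ε : ℕ → ℝ, Tendsto ε atTop (𝓝 0) ∧ ∀ m : ℕ, 1 ≤ m →
      |kernelCoeff p m| =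
        |(2 : ℝ) ^ p * Real.Gamma (p / 2 + 3 / 2) / (√Real.pi * Real.Gamma (-p / 2))| *
          (m : ℝ) ^ (-(p + 3)) * (1 + ε m) := by
  obtain ⟨R, hR, h⟩ := exists_Gamma_ratio_asymptotics (q := p / 2) (by linarith)
    fun n hn => hpn n (by linarith)
  refine ⟨fun m => |R m| - 1, by simpa using hR.abs.sub_const 1, fun m hm => ?_⟩
  have h1 := h m hm
  rw [← neg_div, mul_div_cancel₀ p (two_ne_zero)] at h1
  rw [kernelCoeff_eq_Gamma hpn, mul_assoc, h1, abs_mul, abs_mul,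
    abs_of_nonneg (Real.rpow_nonneg (Nat.cast_nonneg m) _)]
  ring

/-! ### Even exponents -/

theorem kernelCoeff_eq_zero {n m : ℕ} (h : n < m) : kernelCoeff (2 * n) m = 0 := by
  rw [kernelCoeff, mul_div_cancel_left₀ _ (two_ne_zero), charMoment_eq_zero h]
  simp

theorem kernel_two_mul_nat (n : ℕ) (x y : SO3) : (kernel (2 * n) x y : ℂ) =
    ∑ m ∈ Finset.range (n + 1), (kernelCoeff (2 * n) m : ℂ) *
      ∑ k ∈ Finset.Icc (-(m : ℤ)) m, ∑ l ∈ Finset.Icc (-(m : ℤ)) m,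
        wignerD m k l x * (starRingEnd ℂ) (wignerD m k l y) := by
  simp_rw [sum_wignerD_mul_conj]
  rw [kernel_eq, mul_div_cancel_left₀ _ (two_ne_zero), Real.rpow_natCast,
    pow_eq_sum_charMoment n _ n.lt_succ_self, Finset.mul_sum, Complex.ofReal_sum]
  refine Finset.sum_congr rfl fun m _ => ?_
  have hm : (2 * m + 1 : ℂ) ≠ 0 := by exact_mod_cast (2 * m).succ_ne_zero
  rw [kernelCoeff, mul_div_cancel_left₀ _ (two_ne_zero)]
  push_cast
  field_simp

end WignerSO3
open WignerSO3

theorem mainTheorem3 (p : ℝ) (hp : -3 < p) :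
    ∃ a : ℕ → ℝ,
      -- the integrals exist, and their values `a m` do not depend on `k, l`
      (∀ (m : ℕ) (k l : ℤ), |k| ≤ m → |l| ≤ m →
        Integrable (coeffIntegrand p m k l) (haarSO3.prod haarSO3) ∧
        wignerCoeff p m k l = (a m : ℂ)) ∧
      -- the formula, with `Γ(-p/2+m)/Γ(-p/2)` read as the Pochhammer symbol `(-p/2)_m`
      (∀ m : ℕ, a m = (2 : ℝ) ^ p * Real.Gamma (p / 2 + 3 / 2) / Real.sqrt Real.pi *
        ((ascPochhammer ℝ m).eval (-p / 2) / Real.Gamma (p / 2 + 2 + m)) * (1 / (m + 1 / 2))) ∧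
      -- the formula and the asymptotics for `p ∉ 2ℕ`
      ((∀ n : ℕ, p ≠ 2 * n) →
        (∀ m : ℕ, a m =
          (2 : ℝ) ^ p * Real.Gamma (p / 2 + 3 / 2) / (Real.sqrt Real.pi * Real.Gamma (-p / 2)) *
          (Real.Gamma (-p / 2 + m) / Real.Gamma (p / 2 + 2 + m)) * (1 / (m + 1 / 2))) ∧
        ∃ ε : ℕ → ℝ, Tendsto ε atTop (𝓝 0) ∧ ∀ m : ℕ, 1 ≤ m →
          |a m| =
            |(2 : ℝ) ^ p * Real.Gamma (p / 2 + 3 / 2) /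
              (Real.sqrt Real.pi * Real.Gamma (-p / 2))| * (m : ℝ) ^ (-(p + 3)) * (1 + ε m)) ∧
      -- the series terminates for `p ∈ 2ℕ`
      (∀ n : ℕ, p = 2 * n →
        (∀ m : ℕ, n < m → a m = 0) ∧
        ∀ x y : SO3, (kernel p x y : ℂ) =
          ∑ m ∈ Finset.range (n + 1), (a m : ℂ) *
            ∑ k ∈ Finset.Icc (-(m : ℤ)) m, ∑ l ∈ Finset.Icc (-(m : ℤ)) m,
              wignerD m k l x * (starRingEnd ℂ) (wignerD m k l y)) := by
  refine ⟨kernelCoeff p,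
    fun m _ _ hk hl => integrable_coeffIntegrand_and_wignerCoeff hp m hk hl, kernelCoeff_eq p,
    fun hpn => ⟨kernelCoeff_eq_Gamma hpn, kernelCoeff_asymptotics hp hpn⟩, ?_⟩
  rintro n rfl
  exact ⟨fun m h => kernelCoeff_eq_zero h, kernel_two_mul_nat n⟩
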